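/- Let $X\subseteq\mathbb{R}^d$ be Lebesgue measurable, equipped with the $\sigma$-algebra $\mathcal{F}$ of its Lebesgue-measurable subsets, and let $\|\cdot\|$ be a norm on $\mathbb{R}^d$. Let $\pi,\hat\pi:\overline{X}\to(0,\infty)$ be continuous and strictly positive on the closure of $X$, with $\int_X\pi(x)\,dx=1$; write $\pi$ also for the distribution on $X$ with this density. Let $q$ be a proposal density on $X$: $q\ge 0$ is jointly measurable and $\int_X q(x,y)\,dy=1$ for all $x\in X$. Put $$r(x,y)=\frac{\pi(y)q(y,x)}{\pi(x)q(x,y)},\qquad r_1(x,y)=\frac{\hat\pi(y)q(y,x)}{\hat\pi(x)q(x,y)},\qquad r_2(x,y)=\frac{\pi(y)/\hat\pi(y)}{\pi(x)/\hat\pi(x)},$$ $\alpha_{MH}=1\wedge r$ and $\alpha_{DA}=(1\wedge r_1)(1\wedge r_2)$. For $\alpha\in\{\alpha_{MH},\alpha_{DA}\}$ let $$P(x,dy)=q(x,y)\alpha(x,y)\,dy+\Bigl[1-\int_X q(x,z)\alpha(x,z)\,dz\Bigr]\delta_x(dy);$$ this is the Metropolis-Hastings kernel $P_{MH}$, respectively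 the delayed-acceptance kernel $P_{DA}$. A Markov kernel $P$ with stationary distribution $\pi$ is called variance bounding if, for every $f\in L^2(\pi)$, the limit $\lim_{n\to\infty} n\,\mathrm{Var}\bigl[\frac1n\sum_{i=1}^n f(X_i)\bigr]$ exists and is finite, where $(X_i)_{i\ge1}$ is the Markov chain with kernel $P$ and $X_1\sim\pi$. Let $\Delta(x,y;q)=\log q(y,x)-\log q(x,y)$ and $$C(x)=\{y\in X:\ \mathrm{sign}[\log r_1(x,y)]\,\mathrm{sign}[\log r_2(x,y)]\ge 0\},$$ where points $y$ with $q(x,y)=0$ or $q(y,x)=0$ are counted as belonging to $C(x)$. Assume: 1. ($q$ is local) for every $\varepsilon>0$ there is $\rho<\infty$ such that $\int_{\{y\in X:\|y-x\|\ge\rho\}}q(x,y)\,dy<\varepsilon$ for all $x\in X$; 2. ($\hat\pi$ has heavier tails than $\pi$) there is $r_*>0$ such that, for all $x,y\in X$ with $\|x\|>r_*$ and $\|y\|>r_*$, $\hat\pi(x)\le\hat\pi(y)$ implies $\hat\pi(x)/\pi(x)\ge\hat\pi(y)/\pi(y)$; 3. for every $\varepsilon>0$ there are sets $D(x)\subseteq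 X$ $(x\in X)$ and a function $h:[0,\infty)\to[0,\infty)$ that is bounded on bounded intervals such that, for $\pi$-almost all $x$, $D(x)\in\mathcal{F}$, $\int_{D(x)^c}q(x,y)\,dy\le\varepsilon$ and $$\{y\in D(x):\ |\Delta(x,y;q)|>h(\|y-x\|)\}\subseteq C(x).$$ If $P_{MH}$ is variance bounding, then $P_{DA}$ is variance bounding. -/

import Mathlib

open MeasureTheory ProbabilityTheory Filter Topology
open scoped ENNReal

/-! ### The state space: a subset of `ℝᵈ` with its Lebesgue-measurable sets -/

/-- The points of a set `X ⊆ ℝᵈ`, as a type.  (A type of its own, since the subtype `↥X` carries the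
Borel σ-algebra.) -/
def StateSpace {d : ℕ} (X : Set (EuclideanSpace ℝ (Fin d))) : Type := {x // x ∈ X}

namespace StateSpace

variable {d : ℕ} {X : Set (EuclideanSpace ℝ (Fin d))}

/-- The inclusion of the state space in `ℝᵈ`. -/
def val (x : StateSpace X) : EuclideanSpace ℝ (Fin d) := Subtype.val x

/-- The inclusion of the state space in `ℝᵈ` with its σ-algebra of Lebesgue-measurable sets (the
`volume`-null-measurable sets). -/
def toNull (x : StateSpace X) : NullMeasurableSpace (EuclideanSpace ℝ (Fin d)) volume := x.val

/-- The σ-algebra of Lebesgue-measurable sets in `X`: the traces on `X` of the Lebesgue-measurable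
sets of `ℝᵈ`. -/
noncomputable instance : MeasurableSpace (StateSpace X) := MeasurableSpace.comap toNull inferInstance

/-- Lebesgue measure on the Lebesgue-measurable subsets of `X`. -/
noncomputable def lebesgue (X : Set (EuclideanSpace ℝ (Fin d))) : Measure (StateSpace X) :=
  Measure.comap toNull (volume : Measure (EuclideanSpace ℝ (Fin d))).completion

instance : SigmaFinite (lebesgue X) := by
  by_cases hf : Function.Injective (toNull (X := X)) ∧
      ∀ s : Set (StateSpace X), MeasurableSet s →
        NullMeasurableSet (toNull '' s) (volume : Measure (EuclideanSpace ℝ (Fin d))).completion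
  · have hms : ∀ n : ℕ, MeasurableSet {x : StateSpace X | x.val ∈ Metric.ball 0 (n : ℝ)} :=
      fun n => ⟨(Metric.ball (0 : EuclideanSpace ℝ (Fin d)) n : Set (EuclideanSpace ℝ (Fin d))),
        (measurableSet_ball (x := (0 : EuclideanSpace ℝ (Fin d)))).nullMeasurableSet, rfl⟩
    refine ⟨⟨⟨fun n => {x : StateSpace X | x.val ∈ Metric.ball 0 (n : ℝ)}, fun _ => trivial,
      fun n => ?_, ?_⟩⟩⟩
    · have h := Measure.comap_apply₀ toNull _ hf.1 hf.2 (hms n).nullMeasurableSet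
      refine lt_of_eq_of_lt (h.trans (Measure.completion_apply
        (volume : Measure (EuclideanSpace ℝ (Fin d))) _)) (lt_of_le_of_lt (measure_mono ?_)
          (measure_ball_lt_top (μ := (volume : Measure (EuclideanSpace ℝ (Fin d))))
            (x := 0) (r := (n : ℝ))))
      rintro _ ⟨x, hx, rfl⟩
      exact hx
    · refine Set.eq_univ_of_forall fun x => ?_
      obtain ⟨n, hn⟩ := exists_nat_gt (dist x.val 0)
      exact Set.mem_iUnion.2 ⟨n, hn⟩
  · have : lebesgue X = 0 := by
      unfold lebesgue Measure.comap
      exact dif_neg hf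
    rw [this]
    infer_instance

end StateSpace

/-! ### Markov chains, asymptotic variance and variance bounding kernels -/

section MarkovChain

variable {S : Type*} [MeasurableSpace S]

/-- The joint law `π(dx₀) P(x₀, dx₁) ⋯ P(xₙ₋₁, dxₙ)` of the first `n + 1` states of the Markov
chain with kernel `P` and initial distribution `π`. -/
noncomputable def pathLaw (P : Kernel S S) (π : Measure S) : (n : ℕ) → Measure (Fin (n + 1) → S)
  | 0 => π.map (fun x _ => x)
  | n + 1 =>
      (pathLaw P π n ⊗ₘ P.comap (fun x => x (Fin.last n)) (measurable_pi_apply _)).map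
        (fun p => Fin.snoc (α := fun _ => S) p.1 p.2)

/-- `v ∈ [0, ∞]` is the asymptotic variance of `h` under `P`: the limit, as `n → ∞`, of
`n Var[(h(X₁) + ⋯ + h(Xₙ)) / n]`, where `X₁, X₂, …` is the chain with kernel `P` and `X₁ ∼ π`.
(The sample size is written as `n + 1`.) -/
def IsAsymptoticVariance (P : Kernel S S) (π : Measure S) (h : S → ℝ) (v : ℝ≥0∞) : Prop :=
  Tendsto (fun n : ℕ => ((n + 1 : ℕ) : ℝ≥0∞) *
      evariance (fun x : Fin (n + 1) → S => (∑ i, h (x i)) / ((n + 1 : ℕ) : ℝ)) (pathLaw P π n))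
    atTop (𝓝 v)

/-- A Markov kernel `P` with stationary distribution `π` is variance bounding if the asymptotic
variance of every `h ∈ L²(π)` is finite. -/
def IsVarianceBounding (P : Kernel S S) (π : Measure S) : Prop :=
  ∀ h : S → ℝ, MemLp h 2 π → ∃ v : ℝ≥0∞, v < ∞ ∧ IsAsymptoticVariance P π h v

/-! ### Metropolis-Hastings and delayed-acceptance kernels -/

/-- The propose-accept-reject kernel with proposal density `q(x, y)` (with respect to `μ`) and
acceptance probability `α(x, y)`, which is
`q(x, y) α(x, y) μ(dy) + [1 - ∫ q(x, z) α(x, z) μ(dz)] δₓ(dy)`. -/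
noncomputable def proposeAcceptReject (μ : Measure S) [SFinite μ] (q α : S → S → ℝ) : Kernel S S :=
  Kernel.withDensity (Kernel.const S μ) (fun x y => ENNReal.ofReal (q x y * α x y)) +
    Kernel.withDensity Kernel.id (fun x _ => 1 - ∫⁻ z, ENNReal.ofReal (q x z * α x z) ∂μ)

/-- `q` is a proposal density: jointly measurable, non-negative, and `∫ q(x, y) μ(dy) = 1` for
all `x`. -/
structure IsProposalDensity (μ : Measure S) (q : S → S → ℝ) : Prop where
  measurable : Measurable (Function.uncurry q)
  nonneg : ∀ x y, 0 ≤ q x y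
  lintegral_eq_one : ∀ x, ∫⁻ y, ENNReal.ofReal (q x y) ∂μ = 1

end MarkovChain

section Ratios

variable {S : Type*}

/-- The Metropolis-Hastings ratio `r(x, y) = π(y) q(y, x) / (π(x) q(x, y))`. -/
noncomputable def ratioMH (π : S → ℝ) (q : S → S → ℝ) (x y : S) : ℝ :=
  (π y * q y x) / (π x * q x y)

/-- The ratio of the correction stage of delayed acceptance,
`r₂(x, y) = (π(y) / π'(y)) / (π(x) / π'(x))`, for the surrogate `π'`. -/
noncomputable def ratioDA₂ (π π' : S → ℝ) (x y : S) : ℝ :=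
  (π y / π' y) / (π x / π' x)

/-- The Metropolis-Hastings acceptance probability. -/
noncomputable def acceptMH (π : S → ℝ) (q : S → S → ℝ) (x y : S) : ℝ :=
  min 1 (ratioMH π q x y)

/-- The delayed-acceptance acceptance probability `[1 ∧ r₁(x, y)] [1 ∧ r₂(x, y)]`; the ratio `r₁` of
the screening stage is the Metropolis-Hastings ratio for the surrogate `π'`. -/
noncomputable def acceptDA (π π' : S → ℝ) (q : S → S → ℝ) (x y : S) : ℝ :=
  min 1 (ratioMH π' q x y) * min 1 (ratioDA₂ π π' x y)

/-- `Δ(x, y; q) = log q(y, x) - log q(x, y)`. -/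
noncomputable def logProposalRatio (q : S → S → ℝ) (x y : S) : ℝ :=
  Real.log (q y x) - Real.log (q x y)

/-- The "no problem" set `C(x) = {y : sign(log r₁(x, y)) sign(log r₂(x, y)) ≥ 0}`.
Since `Real.log 0 = 0`, it contains every `y` with `q(x, y) = 0` or `q(y, x) = 0`: such a `y` is
either never proposed, or both acceptance probabilities are zero. -/
def noProblemSet (π π' : S → ℝ) (q : S → S → ℝ) (x : S) : Set S :=
  {y | 0 ≤ Real.sign (Real.log (ratioMH π' q x y)) * Real.sign (Real.log (ratioDA₂ π π' x y))}

end Ratios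

section Euclidean

open StateSpace

variable {d : ℕ} {X : Set (EuclideanSpace ℝ (Fin d))}

/-- The distribution on `X` with density `π` with respect to Lebesgue measure. -/
noncomputable def target (π : StateSpace X → ℝ) : Measure (StateSpace X) :=
  (lebesgue X).withDensity (fun x => ENNReal.ofReal (π x))

/-- The Metropolis-Hastings kernel with target density `π` and proposal density `q`. -/
noncomputable def kernelMH (π : StateSpace X → ℝ) (q : StateSpace X → StateSpace X → ℝ) :
    Kernel (StateSpace X) (StateSpace X) :=
  proposeAcceptReject (lebesgue X) q (acceptMH π q)

/-- The delayed-acceptance kernel with target density `π`, surrogate `π'` and proposal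
density `q`. -/
noncomputable def kernelDA (π π' : StateSpace X → ℝ) (q : StateSpace X → StateSpace X → ℝ) :
    Kernel (StateSpace X) (StateSpace X) :=
  proposeAcceptReject (lebesgue X) q (acceptDA π π' q)

/-- The proposal `q` is local with respect to the norm `N`: for each `ε > 0` there is a radius `r`
with `∫_{B(x, r)ᶜ} q(x, y) dy < ε` for all `x ∈ X`, where `B(x, r) = {y ∈ X : N(y - x) < r}`. -/
def IsLocalProposal (N : Seminorm ℝ (EuclideanSpace ℝ (Fin d)))
    (q : StateSpace X → StateSpace X → ℝ) : Prop :=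
  ∀ ε : ℝ, 0 < ε → ∃ r : ℝ, ∀ x : StateSpace X,
    ∫⁻ y in {y : StateSpace X | N (y.val - x.val) < r}ᶜ, ENNReal.ofReal (q x y) ∂(lebesgue X)
      < ENNReal.ofReal ε

/-- `π'` has heavy tails with respect to `π`: there is `r > 0` such that, for `x, y ∈ X` with
`N x > r` and `N y > r`, `π'(x) ≤ π'(y)` implies `π'(x) / π(x) ≥ π'(y) / π(y)`. -/
def HasHeavyTails (N : Seminorm ℝ (EuclideanSpace ℝ (Fin d))) (π' π : StateSpace X → ℝ) : Prop :=
  ∃ r : ℝ, 0 < r ∧ ∀ x y : StateSpace X, r < N x.val → r < N y.val →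
    π' x ≤ π' y → π' y / π y ≤ π' x / π x

end Euclidean

/-! For a reversible kernel, variance bounding is equivalent to positive conductance: the stationary
flow from `A` to its complement is at least `κ π(A)` whenever `π(A) ≤ 1/2`. Rejections never leave a
point, so this flow sees only the accepted moves, and conductance tolerates small errors. If `α_DA ≥
c α_MH` outside proposals of mass at most `ε` for almost every starting point, the flow out of `A`
under `P_DA` is at least `c (κ - ε) π(A)`; take `ε = κ/2` (`hasPositiveConductance_of_accept_le`). A
comparison of Dirichlet forms for general functions would not absorb the exceptional proposals in
this way.

The comparison of acceptance probabilities (`exists_acceptDA_lt_mass_le`) discards proposals outside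
`D(x)` or at distance at least `ρ`. Among the others, if `|Δ|` exceeds its bound `H` then `y ∈
C(x)`, so `r₁` and `r₂` lie on the same side of `1` and splitting the acceptance loses nothing. If
`|Δ| ≤ H` and both points are far out, heavy tails put `π'(y)/π'(x)` and `r₂` on the same side of
`1`, and the proposal ratio costs at most a factor `exp (-H)`. Otherwise both points lie in a
bounded region, where compactness bounds both acceptance factors below.

The equivalence rests on writing `n Var` as the quadratic form of a Fejér mean of the centred Markov
operator `R` on `L²(π)` (`evariance_average_pathLaw`). If these forms are bounded for each function,
Banach-Steinhaus bounds the Fejér means in norm. A nearly invariant vector would make them large, so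
`1 - R` is coercive, and centred indicators give conductance. Conversely, Cheeger's inequality makes
`1 - R` coercive, Lax-Milgram solves the Poisson equation `h = g - R g`, and the Fejér sums
telescope to a finite limit. Only spectrum near `1` matters; no spectral theorem is needed. -/

/-! ### Cesàro sums of the powers of a symmetric contraction -/

section Contraction

open scoped InnerProductSpace

variable {H : Type*} [NormedAddCommGroup H] [InnerProductSpace ℝ H]

/-- The operator `(n + 1)⁻¹ ∑_{i, j ≤ n} R^|i - j|`. -/
noncomputable def fejerOp (R : H →L[ℝ] H) (n : ℕ) : H →L[ℝ] H :=
  ((n + 1 : ℕ) : ℝ)⁻¹ • ∑ j ∈ Finset.range (n + 1),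
    (1 + (2 : ℝ) • ∑ k ∈ Finset.range j, R ^ (k + 1))

lemma inner_fejerOp (R : H →L[ℝ] H) (n : ℕ) (h g : H) :
    ⟪h, fejerOp R n g⟫_ℝ = ((n + 1 : ℕ) : ℝ)⁻¹ * ∑ j ∈ Finset.range (n + 1),
      (⟪h, g⟫_ℝ + 2 * ∑ k ∈ Finset.range j, ⟪h, (R ^ (k + 1)) g⟫_ℝ) := by
  simp [fejerOp, inner_smul_right, inner_sum, inner_add_right]

lemma pow_apply_comm_of_symmetric {R : H →L[ℝ] H} (hR : ∀ x y, ⟪x, R y⟫_ℝ = ⟪R x, y⟫_ℝ) (k : ℕ)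
    (x y : H) : ⟪x, (R ^ k) y⟫_ℝ = ⟪(R ^ k) x, y⟫_ℝ := by
  induction k generalizing x y with
  | zero => simp
  | succ k ih =>
    rw [pow_succ, mul_apply_eq_comp, ih, hR, ← pow_succ, pow_succ', mul_apply_eq_comp]

lemma norm_pow_apply_le_of_contraction {R : H →L[ℝ] H} (hR : ∀ x, ‖R x‖ ≤ ‖x‖) (k : ℕ) (x : H) :
    ‖(R ^ k) x‖ ≤ ‖x‖ := by
  induction k with
  | zero => simp
  | succ k ih =>
    rw [pow_succ', mul_apply_eq_comp]
    exact (hR _).trans ih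

lemma norm_pow_apply_sub_le {R : H →L[ℝ] H} (hR : ∀ x, ‖R x‖ ≤ ‖x‖) (k : ℕ) (x : H) :
    ‖x - (R ^ k) x‖ ≤ k * ‖x - R x‖ := by
  induction k with
  | zero => simp
  | succ k ih =>
    have h1 : x - (R ^ (k + 1)) x = (x - (R ^ k) x) + (R ^ k) (x - R x) := by
      rw [pow_succ, mul_apply_eq_comp, map_sub]; abel
    rw [h1]
    refine (norm_add_le _ _).trans ?_
    have := norm_pow_apply_le_of_contraction hR k (x - R x)
    rw [Nat.cast_add_one]
    linarith

/-- Expand the square and use `‖R x‖ ≤ ‖x‖`. This converts a lower bound on `‖x - R x‖` into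
coercivity of `1 - R`. -/
lemma norm_sub_apply_sq_le {R : H →L[ℝ] H} (hR : ∀ x, ‖R x‖ ≤ ‖x‖) (x : H) :
    ‖x - R x‖ ^ 2 ≤ 2 * ⟪x, x - R x⟫_ℝ := by
  rw [norm_sub_sq_real, inner_sub_right, real_inner_self_eq_norm_sq]
  have := pow_le_pow_left₀ (norm_nonneg _) (hR x) 2
  linarith

lemma sum_pow_succ_apply {R : H →L[ℝ] H} (g : H) (n : ℕ) :
    ∑ k ∈ Finset.range n, (R ^ (k + 1)) (g - R g) = R g - (R ^ (n + 1)) g := by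
  induction n with
  | zero => simp
  | succ n ih =>
    rw [Finset.sum_range_succ, ih, map_sub, pow_succ R (n + 1), mul_apply_eq_comp]
    abel

/-- The double sum has `(n + 1)²` terms, each at least `b`, and is divided by `n + 1`. -/
lemma inner_fejerOp_le {R : H →L[ℝ] H} {n : ℕ} {h : H} {b : ℝ}
    (hb : ∀ k ≤ n, b ≤ ⟪h, (R ^ k) h⟫_ℝ) : (n + 1) * b ≤ ⟪h, fejerOp R n h⟫_ℝ := by
  rw [inner_fejerOp, inv_mul_eq_div, le_div_iff₀ (by positivity)]
  have key : ∀ m ≤ n + 1, (m : ℝ) * (m * b) ≤ ∑ j ∈ Finset.range m,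
      (⟪h, h⟫_ℝ + 2 * ∑ k ∈ Finset.range j, ⟪h, (R ^ (k + 1)) h⟫_ℝ) := by
    intro m hm
    induction m with
    | zero => simp
    | succ m ih =>
      rw [Finset.sum_range_succ]
      have h1 := ih (by omega)
      have h2 : (m : ℝ) * b ≤ ∑ k ∈ Finset.range m, ⟪h, (R ^ (k + 1)) h⟫_ℝ := by
        have := Finset.card_nsmul_le_sum (Finset.range m) (fun k => ⟪h, (R ^ (k + 1)) h⟫_ℝ) b
          (fun k hk => hb _ (by have := Finset.mem_range.1 hk; omega))
        simpa using this
      have h3 := hb 0 (by omega)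
      simp only [pow_zero, one_apply_eq_self] at h3
      rw [Nat.cast_add_one]
      nlinarith
  have := key (n + 1) le_rfl
  rw [Nat.cast_add_one] at this ⊢
  linarith

lemma fejerOp_symmetric {R : H →L[ℝ] H} (hR : ∀ x y, ⟪x, R y⟫_ℝ = ⟪R x, y⟫_ℝ) (n : ℕ) (x y : H) :
    ⟪x, fejerOp R n y⟫_ℝ = ⟪fejerOp R n x, y⟫_ℝ := by
  rw [real_inner_comm y, inner_fejerOp, inner_fejerOp]
  simp only [pow_apply_comm_of_symmetric hR _ x y, real_inner_comm y]

variable [CompleteSpace H]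

/-- Symmetric operators whose quadratic forms are pointwise bounded are uniformly bounded in
norm. -/
lemma exists_norm_le_of_quadratic_bounded {F : ℕ → H →L[ℝ] H}
    (hF : ∀ n x y, ⟪x, F n y⟫_ℝ = ⟪F n x, y⟫_ℝ)
    (hb : ∀ h, ∃ C, ∀ n, |⟪h, F n h⟫_ℝ| ≤ C) : ∃ K, ∀ n, ‖F n‖ ≤ K := by
  -- Uniform boundedness is used twice: for the functionals `⟪F n h, ·⟫` with `h` fixed, then for
  -- the operators `F n`.
  refine banach_steinhaus fun h => ?_
  have : ∃ K, ∀ n, ‖innerSL ℝ (F n h)‖ ≤ K := by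
    refine banach_steinhaus fun g => ?_
    obtain ⟨C, hC⟩ := hb (h + g)
    obtain ⟨C', hC'⟩ := hb (h - g)
    refine ⟨(C + C') / 4, fun n => ?_⟩
    -- Polarization, available because `F n` is symmetric.
    have h1 : ⟪F n h, g⟫_ℝ = (⟪h + g, F n (h + g)⟫_ℝ - ⟪h - g, F n (h - g)⟫_ℝ) / 4 := by
      simp only [map_add, map_sub, inner_add_left, inner_add_right, inner_sub_left,
        inner_sub_right]
      have e1 := hF n h g
      have e2 : ⟪g, F n h⟫_ℝ = ⟪F n h, g⟫_ℝ := real_inner_comm _ _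
      rw [e1, e2]; ring
    rw [innerSL_apply_apply, h1, Real.norm_eq_abs, abs_div, abs_of_pos (by norm_num : (0 : ℝ) < 4)]
    have := abs_sub (⟪h + g, F n (h + g)⟫_ℝ) (⟪h - g, F n (h - g)⟫_ℝ)
    have := hC n
    have := hC' n
    gcongr
    linarith
  obtain ⟨K, hK⟩ := this
  exact ⟨K, fun n => by simpa using hK n⟩

/-- If the averages `⟪h, fejerOp R n h⟫` are bounded for every `h`, then `1 - R` is coercive. -/
theorem coercive_of_fejerOp_bounded {R : H →L[ℝ] H} (hR : ∀ x y, ⟪x, R y⟫_ℝ = ⟪R x, y⟫_ℝ)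
    (hR1 : ∀ x, ‖R x‖ ≤ ‖x‖) (hb : ∀ h, ∃ C, ∀ n, |⟪h, fejerOp R n h⟫_ℝ| ≤ C) :
    ∃ c > 0, ∀ h, c * ‖h‖ ^ 2 ≤ ⟪h, h - R h⟫_ℝ := by
  obtain ⟨K, hK⟩ := exists_norm_le_of_quadratic_bounded (fejerOp_symmetric hR) hb
  -- `N` is both a norm bound and the order of the Fejér mean: on a vector almost fixed by `R` the
  -- form is close to `(N + 1)‖h‖²`, yet it is at most `N ‖h‖²`. This forces `‖h‖ ≤ (N + 1)² ‖h - R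
  -- h‖`, whence the constant below.
  obtain ⟨N, hN⟩ := exists_nat_gt K
  refine ⟨1 / (2 * (N + 1) ^ 4), by positivity, fun h => ?_⟩
  set η := ‖h - R h‖ with hη
  have hη0 : 0 ≤ η := norm_nonneg _
  have hh0 := norm_nonneg h
  have h1 : ∀ k ≤ N, ‖h‖ ^ 2 - N * η * ‖h‖ ≤ ⟪h, (R ^ k) h⟫_ℝ := by
    intro k hk
    have e : ⟪h, (R ^ k) h⟫_ℝ = ‖h‖ ^ 2 - ⟪h, h - (R ^ k) h⟫_ℝ := by
      rw [inner_sub_right, real_inner_self_eq_norm_sq]; ring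
    rw [e]
    have h2 := real_inner_le_norm h (h - (R ^ k) h)
    have h3 := norm_pow_apply_sub_le hR1 k h
    have h4 : (k : ℝ) * η ≤ N * η := by gcongr
    have : ‖h‖ * ‖h - (R ^ k) h‖ ≤ ‖h‖ * (N * η) := by gcongr; exact h3.trans h4
    linarith
  have h2 := inner_fejerOp_le h1
  have h3 : ⟪h, fejerOp R N h⟫_ℝ ≤ N * ‖h‖ ^ 2 := by
    refine (real_inner_le_norm _ _).trans ?_
    have := (fejerOp R N).le_of_opNorm_le ((hK N).trans hN.le) h
    calc ‖h‖ * ‖fejerOp R N h‖ ≤ ‖h‖ * (N * ‖h‖) := by gcongr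
      _ = _ := by ring
  have h4 : ‖h‖ ≤ (N + 1) ^ 2 * η := by
    have hN0 : (0 : ℝ) ≤ N := Nat.cast_nonneg N
    by_contra hlt
    push Not at hlt
    have hpos : 0 < ‖h‖ := lt_of_le_of_lt (by positivity) hlt
    have h5 : ‖h‖ * ‖h‖ ≤ ((N + 1) ^ 2 * η) * ‖h‖ := by
      have : ((N : ℝ) + 1) * N * η * ‖h‖ ≤ (N + 1) ^ 2 * η * ‖h‖ := by
        gcongr; nlinarith
      nlinarith
    exact absurd (le_of_mul_le_mul_right h5 hpos) (not_le.2 hlt)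
  have h5 := norm_sub_apply_sq_le hR1 h
  rw [div_mul_eq_mul_div, one_mul, div_le_iff₀ (by positivity)]
  calc ‖h‖ ^ 2 ≤ ((N + 1) ^ 2 * η) ^ 2 := by gcongr
    _ = (N + 1) ^ 4 * η ^ 2 := by ring
    _ ≤ (N + 1) ^ 4 * (2 * ⟪h, h - R h⟫_ℝ) := by gcongr
    _ = _ := by ring

/-- Lax-Milgram for the coercive form `⟪u - R u, w⟫` solves the Poisson equation. -/
lemma exists_sub_apply_eq {R : H →L[ℝ] H} {c : ℝ} (hc : 0 < c)
    (hR : ∀ h, c * ‖h‖ ^ 2 ≤ ⟪h, h - R h⟫_ℝ) (h : H) : ∃ g, g - R g = h := by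
  let B : H →L[ℝ] H →L[ℝ] ℝ := (innerSL ℝ).comp (1 - R)
  have hB : IsCoercive B := ⟨c, hc, fun u => by
    have := hR u
    rw [real_inner_comm] at this
    simpa [B, pow_two, mul_assoc, inner_sub_left] using this⟩
  obtain ⟨g, hg⟩ := hB.continuousLinearEquivOfBilin.surjective h
  refine ⟨g, ?_⟩
  rw [← hg]
  refine ext_inner_right ℝ fun w => ?_
  rw [hB.continuousLinearEquivOfBilin_apply]
  simp [B, inner_sub_left]

/-- If `1 - R` is coercive, then the averages `⟪h, fejerOp R n h⟫` converge for every `h`. -/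
theorem tendsto_inner_fejerOp_of_coercive {R : H →L[ℝ] H}
    (hR : ∀ x y, ⟪x, R y⟫_ℝ = ⟪R x, y⟫_ℝ) (hR1 : ∀ x, ‖R x‖ ≤ ‖x‖) {c : ℝ} (hc : 0 < c)
    (hRc : ∀ h, c * ‖h‖ ^ 2 ≤ ⟪h, h - R h⟫_ℝ) (h : H) :
    ∃ v, Tendsto (fun n => ⟪h, fejerOp R n h⟫_ℝ) atTop (𝓝 v) := by
  obtain ⟨g, rfl⟩ := exists_sub_apply_eq hc hRc h
  set h := g - R g with hh
  refine ⟨⟪h, h⟫_ℝ + 2 * ⟪h, R g⟫_ℝ, ?_⟩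
  -- Both the inner and the outer sum telescope, since `h = g - R g`; the remainder is a bounded
  -- quantity over `n + 1`.
  have e : ∀ n, ⟪h, fejerOp R n h⟫_ℝ = ⟪h, h⟫_ℝ + 2 * ⟪h, R g⟫_ℝ
      - ((n + 1 : ℕ) : ℝ)⁻¹ * (2 * ⟪R g - (R ^ (n + 2)) g, g⟫_ℝ) := by
    intro n
    rw [inner_fejerOp]
    have hs : ∀ j, ∑ k ∈ Finset.range j, ⟪h, (R ^ (k + 1)) h⟫_ℝ =
        ⟪h, R g⟫_ℝ - ⟪h, (R ^ (j + 1)) g⟫_ℝ := fun j => by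
      rw [← inner_sum, ← inner_sub_right, ← sum_pow_succ_apply]
    simp_rw [hs]
    have : ∑ j ∈ Finset.range (n + 1), ⟪h, (R ^ (j + 1)) g⟫_ℝ =
        ⟪R g - (R ^ (n + 2)) g, g⟫_ℝ := by
      simp_rw [pow_apply_comm_of_symmetric hR _ h g, ← sum_inner]
      rw [hh, sum_pow_succ_apply]
    rw [← this]
    simp_rw [mul_sub, Finset.sum_add_distrib, Finset.sum_sub_distrib, ← Finset.mul_sum]
    simp only [Finset.sum_const, Finset.card_range, nsmul_eq_mul]
    field_simp
    ring
  simp_rw [e]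
  rw [← sub_zero (_ + _)]
  refine Tendsto.sub (by simp) ?_
  have hinv : Tendsto (fun n : ℕ => ((n + 1 : ℕ) : ℝ)⁻¹) atTop (𝓝 0) :=
    (tendsto_inv_atTop_zero.comp tendsto_natCast_atTop_atTop).comp (tendsto_add_atTop_nat 1)
  refine hinv.zero_mul_isBoundedUnder_le ?_
  refine isBoundedUnder_of ⟨2 * ((‖g‖ + ‖g‖) * ‖g‖), fun n => ?_⟩
  simp only [Function.comp, norm_mul, Real.norm_ofNat]
  gcongr
  refine (norm_inner_le_norm _ _).trans ?_
  gcongr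
  refine (norm_sub_le _ _).trans ?_
  gcongr
  · exact hR1 g
  · exact norm_pow_apply_le_of_contraction hR1 _ g

end Contraction

/-! ### Splitting off an invariant unit vector. -/

section Deflation

open scoped InnerProductSpace

variable {H : Type*} [NormedAddCommGroup H] [InnerProductSpace ℝ H]

/-- The operator `R` minus the orthogonal projection on the line spanned by the unit vector `e`. -/
noncomputable def deflate (R : H →L[ℝ] H) (e : H) : H →L[ℝ] H :=
  R - (innerSL ℝ e).smulRight e

lemma deflate_apply (R : H →L[ℝ] H) (e x : H) : deflate R e x = R x - ⟪e, x⟫_ℝ • e := by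
  simp [deflate]

lemma deflate_symmetric {R : H →L[ℝ] H} (hR : ∀ x y, ⟪x, R y⟫_ℝ = ⟪R x, y⟫_ℝ) (e x y : H) :
    ⟪x, deflate R e y⟫_ℝ = ⟪deflate R e x, y⟫_ℝ := by
  rw [deflate_apply, deflate_apply, inner_sub_left, inner_sub_right, hR, inner_smul_left,
    inner_smul_right, real_inner_comm e x]
  simp [mul_comm]

/-- Because `R` fixes `e`, deflation is `R` applied after the orthogonal projection off `e`. -/
lemma norm_deflate_apply_le {R : H →L[ℝ] H} (hR : ∀ x, ‖R x‖ ≤ ‖x‖) {e : H} (he : ‖e‖ = 1)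
    (hRe : R e = e) (x : H) : ‖deflate R e x‖ ≤ ‖x‖ := by
  have h1 : deflate R e x = R (x - ⟪e, x⟫_ℝ • e) := by
    rw [deflate_apply, map_sub, map_smul, hRe]
  rw [h1]
  refine (hR _).trans ?_
  refine le_of_sq_le_sq ?_ (norm_nonneg _)
  rw [norm_sub_sq_real, inner_smul_right, real_inner_comm, norm_smul, he]
  simp only [Real.norm_eq_abs, mul_one, sq_abs]
  nlinarith [sq_nonneg ⟪e, x⟫_ℝ]

lemma deflate_pow_apply {R : H →L[ℝ] H} (hR : ∀ x y, ⟪x, R y⟫_ℝ = ⟪R x, y⟫_ℝ) {e : H}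
    (hRe : R e = e) {x : H} (hx : ⟪e, x⟫_ℝ = 0) (k : ℕ) :
    (deflate R e ^ k) x = (R ^ k) x := by
  have h0 : ∀ k, ⟪e, (R ^ k) x⟫_ℝ = 0 := by
    intro k
    induction k with
    | zero => simpa using hx
    | succ k ih => rw [pow_succ', mul_apply_eq_comp, hR, hRe, ih]
  induction k with
  | zero => simp
  | succ k ih =>
    rw [pow_succ', mul_apply_eq_comp, ih, deflate_apply, h0, zero_smul, sub_zero, pow_succ',
      mul_apply_eq_comp]

lemma deflate_self_apply {R : H →L[ℝ] H} {e : H} (he : ‖e‖ = 1) (hRe : R e = e) :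
    deflate R e e = 0 := by
  rw [deflate_apply, real_inner_self_eq_norm_sq, he, hRe]; simp

lemma fejerOp_apply_of_apply_eq_zero {R : H →L[ℝ] H} {e : H} (hRe : R e = 0) (n : ℕ) :
    fejerOp R n e = e := by
  have h0 : ∀ k, (R ^ (k + 1)) e = 0 := fun k => by
    rw [pow_succ, mul_apply_eq_comp, hRe, map_zero]
  refine ext_inner_left ℝ fun h => ?_
  rw [inner_fejerOp]
  simp only [h0, inner_zero_right, Finset.sum_const_zero, mul_zero, add_zero, Finset.sum_const,
    Finset.card_range, nsmul_eq_mul]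
  rw [← mul_assoc, inv_mul_cancel₀ (by positivity), one_mul]

/-- The Fejér means fix the kernel vector `e` and are symmetric, so the cross terms vanish.
Boundedness of the forms thus reduces to vectors orthogonal to `e`. -/
lemma inner_fejerOp_of_apply_eq_zero {R : H →L[ℝ] H} (hR : ∀ x y, ⟪x, R y⟫_ℝ = ⟪R x, y⟫_ℝ) {e : H}
    (he : ‖e‖ = 1) (hRe : R e = 0) (n : ℕ) (x : H) :
    ⟪x, fejerOp R n x⟫_ℝ = ⟪e, x⟫_ℝ ^ 2 +
      ⟪x - ⟪e, x⟫_ℝ • e, fejerOp R n (x - ⟪e, x⟫_ℝ • e)⟫_ℝ := by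
  have h1 : ⟪e, fejerOp R n x⟫_ℝ = ⟪e, x⟫_ℝ := by
    rw [fejerOp_symmetric hR, fejerOp_apply_of_apply_eq_zero hRe]
  simp only [map_sub, map_smul, fejerOp_apply_of_apply_eq_zero hRe, inner_sub_left,
    inner_sub_right, inner_smul_left, inner_smul_right, h1, real_inner_self_eq_norm_sq, he,
    real_inner_comm e x]
  simp
  ring

end Deflation

/-! ### The operator of a reversible kernel on `L²` -/

section MarkovOperator

open scoped InnerProductSpace

variable {S : Type*} [MeasurableSpace S] {P : Kernel S S} [IsMarkovKernel P] {π : Measure S}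
  [IsProbabilityMeasure π]

lemma compProd_map_swap_of_isReversible (h : P.IsReversible π) :
    (π ⊗ₘ P).map Prod.swap = π ⊗ₘ P := by
  refine Measure.ext_prod fun {s t} hs ht => ?_
  rw [Measure.map_apply measurable_swap (hs.prod ht), Set.preimage_swap_prod,
    Measure.compProd_apply_prod ht hs, Measure.compProd_apply_prod hs ht, h ht hs]

lemma measurePreserving_fst_compProd {T : Type*} [MeasurableSpace T] {P : Kernel S T}
    [IsMarkovKernel P] : MeasurePreserving Prod.fst (π ⊗ₘ P) π :=
  ⟨measurable_fst, Measure.fst_compProd π P⟩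

lemma measurePreserving_snd_compProd (h : P.IsReversible π) :
    MeasurePreserving Prod.snd (π ⊗ₘ P) π := by
  refine ⟨measurable_snd, ?_⟩
  conv_lhs => rw [← compProd_map_swap_of_isReversible h]
  rw [Measure.map_map measurable_snd measurable_swap]
  exact Measure.fst_compProd π P

/-- The operator on `L²(π)` of a `π`-reversible Markov kernel. -/
noncomputable def markovOp (h : P.IsReversible π) : Lp ℝ 2 π →L[ℝ] Lp ℝ 2 π :=
  (ContinuousLinearMap.adjoint (Lp.compMeasurePreservingₗᵢ ℝ Prod.fst
      (measurePreserving_fst_compProd (P := P) (π := π))).toContinuousLinearMap).comp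
    (Lp.compMeasurePreservingₗᵢ ℝ Prod.snd
      (measurePreserving_snd_compProd h)).toContinuousLinearMap

/-- The operator is the adjoint of one isometric pullback to `L²(π ⊗ₘ P)` composed with another,
which makes this formula, and the contraction property, immediate. -/
lemma inner_markovOp (h : P.IsReversible π) (f g : Lp ℝ 2 π) :
    ⟪f, markovOp h g⟫_ℝ = ∫ p, f p.1 * g p.2 ∂(π ⊗ₘ P) := by
  rw [markovOp, ContinuousLinearMap.comp_apply, ContinuousLinearMap.adjoint_inner_right,
    L2.inner_def]
  refine integral_congr_ae ?_
  filter_upwards [Lp.coeFn_compMeasurePreserving f (measurePreserving_fst_compProd (P := P)),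
    Lp.coeFn_compMeasurePreserving g (measurePreserving_snd_compProd h)] with p h1 h2
  change (Lp.compMeasurePreserving Prod.snd (measurePreserving_snd_compProd h) g : S × S → ℝ) p *
    (Lp.compMeasurePreserving Prod.fst measurePreserving_fst_compProd f : S × S → ℝ) p = _
  rw [h1, h2]
  exact mul_comm _ _

lemma norm_markovOp_apply_le (h : P.IsReversible π) (f : Lp ℝ 2 π) : ‖markovOp h f‖ ≤ ‖f‖ := by
  rw [markovOp, ContinuousLinearMap.comp_apply]
  refine (ContinuousLinearMap.le_of_opNorm_le _ (c := 1) ?_ _).trans ?_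
  · rw [ContinuousLinearMap.adjoint.norm_map]
    exact LinearIsometry.norm_toContinuousLinearMap_le _
  · rw [one_mul, LinearIsometry.coe_toContinuousLinearMap, LinearIsometry.norm_map]

lemma markovOp_symmetric (h : P.IsReversible π) (f g : Lp ℝ 2 π) :
    ⟪f, markovOp h g⟫_ℝ = ⟪markovOp h f, g⟫_ℝ := by
  rw [real_inner_comm g, inner_markovOp, inner_markovOp]
  conv_lhs => rw [← compProd_map_swap_of_isReversible h]
  refine (integral_map_equiv MeasurableEquiv.prodComm (fun p : S × S => f p.1 * g p.2)).trans ?_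
  exact integral_congr_ae (.of_forall fun p => mul_comm _ _)

lemma integrable_mul_compProd (h : P.IsReversible π) {f g : S → ℝ} (hf : MemLp f 2 π)
    (hg : MemLp g 2 π) : Integrable (fun p : S × S => f p.1 * g p.2) (π ⊗ₘ P) :=
  (hf.comp_measurePreserving measurePreserving_fst_compProd).integrable_mul
    (hg.comp_measurePreserving (measurePreserving_snd_compProd h))

lemma markovOp_ae_eq (h : P.IsReversible π) (g : Lp ℝ 2 π) :
    markovOp h g =ᵐ[π] fun x => ∫ y, g y ∂(P x) := by
  have hg2 : Integrable (fun p : S × S => g p.2) (π ⊗ₘ P) :=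
    ((Lp.memLp g).comp_measurePreserving (measurePreserving_snd_compProd h)).integrable (by norm_num)
  refine Integrable.ae_eq_of_forall_setIntegral_eq _ _ ((Lp.memLp _).integrable (by norm_num))
    (hg2.integral_compProd) fun s hs _ => ?_
  have h1 : ⟪indicatorConstLp 2 hs (measure_ne_top π s) (1 : ℝ), markovOp h g⟫_ℝ =
      ∫ x in s, (markovOp h g) x ∂π := by
    rw [L2.inner_indicatorConstLp_one]
  rw [← h1, inner_markovOp]
  have h2 : ∫ p, indicatorConstLp 2 hs (measure_ne_top π s) (1 : ℝ) p.1 * g p.2 ∂(π ⊗ₘ P) =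
      ∫ p in s ×ˢ Set.univ, g p.2 ∂(π ⊗ₘ P) := by
    rw [← integral_indicator (hs.prod MeasurableSet.univ)]
    refine integral_congr_ae ?_
    filter_upwards [measurePreserving_fst_compProd.quasiMeasurePreserving.ae_eq_comp
      (indicatorConstLp_coeFn (p := 2) (hs := hs) (hμs := measure_ne_top π s) (c := (1 : ℝ)))]
      with p hp
    simp only [Function.comp] at hp
    rw [hp]
    by_cases hps : p.1 ∈ s <;> simp [Set.indicator, hps]
  rw [h2, Measure.setIntegral_compProd hs MeasurableSet.univ hg2.integrableOn]
  simp

/-- The constant function `1` in `L²`. -/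
noncomputable def oneL2 (π : Measure S) [IsProbabilityMeasure π] : Lp ℝ 2 π :=
  (memLp_const (1 : ℝ)).toLp (fun _ => 1)

lemma oneL2_ae_eq : oneL2 π =ᵐ[π] fun _ => 1 := MemLp.coeFn_toLp _

lemma inner_oneL2 (f : Lp ℝ 2 π) : ⟪oneL2 π, f⟫_ℝ = ∫ x, f x ∂π := by
  rw [L2.inner_def]
  refine integral_congr_ae ?_
  filter_upwards [oneL2_ae_eq (π := π)] with x hx
  simp [hx]

lemma norm_oneL2 : ‖oneL2 π‖ = 1 := by
  have : ‖oneL2 π‖ ^ 2 = 1 := by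
    rw [← real_inner_self_eq_norm_sq, inner_oneL2, integral_congr_ae oneL2_ae_eq]
    simp
  nlinarith [norm_nonneg (oneL2 π)]

lemma markovOp_oneL2 (h : P.IsReversible π) : markovOp h (oneL2 π) = oneL2 π := by
  refine Lp.ext ?_
  have h1 := Measure.ae_ae_of_ae_compProd
    ((measurePreserving_snd_compProd h).quasiMeasurePreserving.ae oneL2_ae_eq)
  filter_upwards [markovOp_ae_eq h (oneL2 π), oneL2_ae_eq (π := π), h1] with x hx hx1 hx2
  rw [hx, hx1, integral_congr_ae hx2]
  simp

end MarkovOperator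

/-! ### The variance of the ergodic averages of a reversible chain -/

section PathLaw

open scoped InnerProductSpace

variable {S : Type*} [MeasurableSpace S] {P : Kernel S S} [IsMarkovKernel P] {π : Measure S}
  [IsProbabilityMeasure π]

lemma measurable_snoc (n : ℕ) : Measurable
    (fun p : (Fin (n + 1) → S) × S => Fin.snoc (α := fun _ => S) p.1 p.2) := by
  refine measurable_pi_iff.2 fun i => ?_
  induction i using Fin.lastCases with
  | last => simpa using measurable_snd
  | cast i => simpa [Function.comp_def] using (measurable_pi_apply i).comp measurable_fst

instance isProbabilityMeasure_pathLaw (n : ℕ) : IsProbabilityMeasure (pathLaw P π n) := by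
  induction n with
  | zero => exact Measure.isProbabilityMeasure_map (by fun_prop)
  | succ n ih =>
    exact Measure.isProbabilityMeasure_map (measurable_snoc n).aemeasurable

/-- The joint law of the first `n + 2` states of the chain, with the last state kept apart. -/
noncomputable def pathStepLaw (P : Kernel S S) (π : Measure S) (n : ℕ) :
    Measure ((Fin (n + 1) → S) × S) :=
  pathLaw P π n ⊗ₘ P.comap (fun x => x (Fin.last n)) (measurable_pi_apply _)

omit [IsMarkovKernel P] [IsProbabilityMeasure π] in
lemma measurePreserving_snoc (n : ℕ) :
    MeasurePreserving (fun p : (Fin (n + 1) → S) × S => Fin.snoc (α := fun _ => S) p.1 p.2)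
      (pathStepLaw P π n) (pathLaw P π (n + 1)) :=
  ⟨measurable_snoc n, rfl⟩

instance isProbabilityMeasure_pathStepLaw (n : ℕ) : IsProbabilityMeasure (pathStepLaw P π n) := by
  unfold pathStepLaw; infer_instance

lemma measurePreserving_fst_pathStepLaw (n : ℕ) :
    MeasurePreserving Prod.fst (pathStepLaw P π n) (pathLaw P π n) :=
  measurePreserving_fst_compProd

/-- The Markov property: the new state depends on the past only through the last state. -/
lemma measurePreserving_prodMk_pathStepLaw {n : ℕ}
    (hn : MeasurePreserving (fun x : Fin (n + 1) → S => x (Fin.last n)) (pathLaw P π n) π) :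
    MeasurePreserving (fun p : (Fin (n + 1) → S) × S => (p.1 (Fin.last n), p.2))
      (pathStepLaw P π n) (π ⊗ₘ P) := by
  have hm : Measurable (fun p : (Fin (n + 1) → S) × S => (p.1 (Fin.last n), p.2)) := by fun_prop
  have := Measure.isProbabilityMeasure_map (μ := pathStepLaw P π n) hm.aemeasurable
  refine ⟨hm, ?_⟩
  refine Measure.ext_prod fun {s t} hs ht => ?_
  rw [Measure.map_apply hm (hs.prod ht), Measure.compProd_apply_prod hs ht]
  have : (fun p : (Fin (n + 1) → S) × S => (p.1 (Fin.last n), p.2)) ⁻¹' s ×ˢ t =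
      ((fun x : Fin (n + 1) → S => x (Fin.last n)) ⁻¹' s) ×ˢ t := rfl
  rw [this, pathStepLaw, Measure.compProd_apply_prod (hn.measurable hs) ht,
    ← hn.setLIntegral_comp_preimage hs (P.measurable_coe ht)]
  rfl

lemma measurePreserving_eval_pathLaw (h : P.IsReversible π) (n : ℕ) (i : Fin (n + 1)) :
    MeasurePreserving (fun x : Fin (n + 1) → S => x i) (pathLaw P π n) π := by
  induction n with
  | zero =>
    refine ⟨measurable_pi_apply _, ?_⟩
    rw [pathLaw, Measure.map_map (measurable_pi_apply _) (by fun_prop)]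
    exact Measure.map_id
  | succ n ih =>
    refine ⟨measurable_pi_apply _, ?_⟩
    rw [← (measurePreserving_snoc n).map_eq, Measure.map_map (measurable_pi_apply _)
      (measurable_snoc n)]
    induction i using Fin.lastCases with
    | last =>
      have := (measurePreserving_snd_compProd h).comp
        (measurePreserving_prodMk_pathStepLaw (ih (Fin.last n)))
      simpa [Function.comp_def] using this.map_eq
    | cast i =>
      have := (ih i).comp (measurePreserving_fst_pathStepLaw n)
      simpa [Function.comp_def] using this.map_eq

lemma memLp_sum_pathLaw (h : P.IsReversible π) (n : ℕ) {f : S → ℝ} (hf : MemLp f 2 π) :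
    MemLp (fun x : Fin (n + 1) → S => ∑ i, f (x i)) 2 (pathLaw P π n) :=
  memLp_finsetSum _ fun i _ => hf.comp_measurePreserving (measurePreserving_eval_pathLaw h n i)

lemma memLp_snd_pathStepLaw (h : P.IsReversible π) (n : ℕ) {f : S → ℝ} (hf : MemLp f 2 π) :
    MemLp (fun p : (Fin (n + 1) → S) × S => f p.2) 2 (pathStepLaw P π n) :=
  hf.comp_measurePreserving ((measurePreserving_snd_compProd h).comp
    (measurePreserving_prodMk_pathStepLaw (measurePreserving_eval_pathLaw h n (Fin.last n))))

lemma integral_mul_pathStepLaw (h : P.IsReversible π) (n : ℕ) {F : (Fin (n + 1) → S) → ℝ}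
    (hF : MemLp F 2 (pathLaw P π n)) (g : Lp ℝ 2 π) :
    ∫ p, F p.1 * g p.2 ∂(pathStepLaw P π n) =
      ∫ x, F x * markovOp h g (x (Fin.last n)) ∂(pathLaw P π n) := by
  have hint : Integrable (fun p => F p.1 * g p.2) (pathStepLaw P π n) :=
    (hF.comp_measurePreserving (measurePreserving_fst_pathStepLaw n)).integrable_mul
      (memLp_snd_pathStepLaw h n (Lp.memLp g))
  rw [pathStepLaw, Measure.integral_compProd hint]
  refine integral_congr_ae ?_
  filter_upwards [(measurePreserving_eval_pathLaw h n (Fin.last n)).quasiMeasurePreserving.ae_eq_comp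
    (markovOp_ae_eq h g)] with x hx
  simp only [Function.comp_def] at hx
  rw [hx, integral_const_mul]
  rfl

lemma integral_sum_mul_last (h : P.IsReversible π) (f g : Lp ℝ 2 π) (n : ℕ) :
    ∫ x, (∑ i, f (x i)) * g (x (Fin.last n)) ∂(pathLaw P π n) =
      ∑ k ∈ Finset.range (n + 1), ⟪f, (markovOp h ^ k) g⟫_ℝ := by
  have hfg : ∀ g : Lp ℝ 2 π, ⟪f, g⟫_ℝ = ∫ x, f x * g x ∂π := by
    intro g
    rw [L2.inner_def]
    exact integral_congr_ae (.of_forall fun x => mul_comm _ _)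
  have hfgm : ∀ g : Lp ℝ 2 π, AEStronglyMeasurable (fun x => f x * g x) π :=
    fun g => (Lp.aestronglyMeasurable f).mul (Lp.aestronglyMeasurable g)
  -- Conditioning on the past replaces `g` by `markovOp h g`, so the induction needs every `g`.
  induction n generalizing g with
  | zero =>
    have hm := measurePreserving_eval_pathLaw (P := P) h 0 (Fin.last 0)
    have := integral_map hm.measurable.aemeasurable (f := fun x => f x * g x)
      (by rw [hm.map_eq]; exact hfgm g)
    rw [hm.map_eq] at this
    simp [hfg, this]
  | succ n ih =>
    have hs := memLp_sum_pathLaw h n (Lp.memLp f)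
    have hF : Integrable (fun p => (∑ i, f (p.1 i)) * g p.2) (pathStepLaw P π n) :=
      (hs.comp_measurePreserving (measurePreserving_fst_pathStepLaw n)).integrable_mul
      (memLp_snd_pathStepLaw h n (Lp.memLp g))
    have hlast : Integrable (fun p => f p.2 * g p.2) (pathStepLaw P π n) :=
      (memLp_snd_pathStepLaw h n (Lp.memLp f)).integrable_mul
      (memLp_snd_pathStepLaw h n (Lp.memLp g))
    have hm := (measurePreserving_snd_compProd h).comp
      (measurePreserving_prodMk_pathStepLaw (measurePreserving_eval_pathLaw (P := P) h n
        (Fin.last n)))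
    have hmi := integral_map hm.measurable.aemeasurable (f := fun x => f x * g x)
      (by rw [hm.map_eq]; exact hfgm g)
    rw [hm.map_eq] at hmi
    have hsm := (memLp_sum_pathLaw h (n + 1) (Lp.memLp f)).aestronglyMeasurable.mul
      ((Lp.memLp g).comp_measurePreserving
        (measurePreserving_eval_pathLaw h (n + 1) (Fin.last (n + 1)))).aestronglyMeasurable
    have hsnoc := measurePreserving_snoc (P := P) (π := π) n
    rw [← hsnoc.map_eq] at hsm ⊢
    refine (integral_map hsnoc.measurable.aemeasurable hsm).trans ?_
    simp only [Pi.mul_apply, Function.comp_apply, Fin.sum_univ_castSucc (n := n + 1),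
      Fin.snoc_castSucc, Fin.snoc_last, add_mul]
    rw [integral_add hF hlast, integral_mul_pathStepLaw h n hs g, ih,
      Finset.sum_range_succ' _ (n + 1), pow_zero, one_apply_eq_self, hfg g, hmi]
    simp only [pow_succ, mul_apply_eq_comp]
    rfl

/-- Expand `(Sₙ + f(X))²`, where `X` is the new state; the cross term is a sum of lagged
covariances. -/
lemma integral_sum_sq (h : P.IsReversible π) (f : Lp ℝ 2 π) (n : ℕ) :
    ∫ x, (∑ i, f (x i)) ^ 2 ∂(pathLaw P π n) =
      ∑ j ∈ Finset.range (n + 1),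
        (⟪f, f⟫_ℝ + 2 * ∑ k ∈ Finset.range j, ⟪f, (markovOp h ^ (k + 1)) f⟫_ℝ) := by
  have hff : ⟪f, f⟫_ℝ = ∫ x, f x ^ 2 ∂π := by
    rw [L2.inner_def]
    exact integral_congr_ae (.of_forall fun x => (pow_two (f x)).symm)
  have hffm : AEStronglyMeasurable (fun x => f x ^ 2) π := (Lp.aestronglyMeasurable f).pow 2
  induction n with
  | zero =>
    have hm := measurePreserving_eval_pathLaw (P := P) h 0 (Fin.last 0)
    have := integral_map hm.measurable.aemeasurable (f := fun x => f x ^ 2)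
      (by rw [hm.map_eq]; exact hffm)
    rw [hm.map_eq] at this
    simp only [zero_add, Finset.range_one, Finset.sum_singleton, Finset.range_zero,
      Finset.sum_empty, mul_zero, add_zero, hff, this]
    simp
  | succ n ih =>
    have hs := memLp_sum_pathLaw h n (Lp.memLp f)
    have hs1 := hs.comp_measurePreserving (measurePreserving_fst_pathStepLaw n)
    have hF : Integrable (fun p => (∑ i, f (p.1 i)) * f p.2) (pathStepLaw P π n) :=
      hs1.integrable_mul (memLp_snd_pathStepLaw h n (Lp.memLp f))
    have hsq : Integrable (fun p => (∑ i, f (p.1 i)) ^ 2) (pathStepLaw P π n) := hs1.integrable_sq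
    have hsum : Integrable (fun p => (∑ i, f (p.1 i)) ^ 2 + 2 * ((∑ i, f (p.1 i)) * f p.2))
        (pathStepLaw P π n) := hsq.add (hF.const_mul 2)
    have hlast := (memLp_snd_pathStepLaw h n (Lp.memLp f)).integrable_sq
    have hm := (measurePreserving_snd_compProd h).comp
      (measurePreserving_prodMk_pathStepLaw (measurePreserving_eval_pathLaw (P := P) h n
        (Fin.last n)))
    have hmi := integral_map hm.measurable.aemeasurable (f := fun x => f x ^ 2)
      (by rw [hm.map_eq]; exact hffm)
    rw [hm.map_eq] at hmi
    have hfst := integral_map (measurePreserving_fst_pathStepLaw (P := P) (π := π)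
      n).measurable.aemeasurable (f := fun x : Fin (n + 1) → S => (∑ i, f (x i)) ^ 2)
      (by rw [(measurePreserving_fst_pathStepLaw (P := P) (π := π) n).map_eq]; exact hs.aestronglyMeasurable.pow 2)
    rw [(measurePreserving_fst_pathStepLaw (P := P) (π := π) n).map_eq] at hfst
    have hsm := (memLp_sum_pathLaw h (n + 1) (Lp.memLp f)).aestronglyMeasurable.pow 2
    have hsnoc := measurePreserving_snoc (P := P) (π := π) n
    rw [← hsnoc.map_eq] at hsm ⊢
    refine (integral_map hsnoc.measurable.aemeasurable hsm).trans ?_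
    simp only [Pi.pow_apply, Fin.sum_univ_castSucc (n := n + 1), Fin.snoc_castSucc, Fin.snoc_last, add_sq,
      mul_assoc]
    rw [integral_add hsum hlast,
      integral_add hsq (hF.const_mul 2), integral_const_mul,
      integral_mul_pathStepLaw h n hs f, integral_sum_mul_last h, Finset.sum_range_succ _ (n + 1),
      ← ih, hff, hmi, hfst]
    simp only [pow_succ, mul_apply_eq_comp]
    simp only [Function.comp_def]
    ring

/-- The operator `f ↦ ∫ f(y) P(·, dy) - ∫ f dπ` on `L²(π)`. -/
noncomputable def centeredOp (h : P.IsReversible π) : Lp ℝ 2 π →L[ℝ] Lp ℝ 2 π :=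
  deflate (markovOp h) (oneL2 π)

lemma inner_fejerOp_centeredOp (h : P.IsReversible π) {f : Lp ℝ 2 π} (hf : ⟪oneL2 π, f⟫_ℝ = 0)
    (n : ℕ) : ⟪f, fejerOp (centeredOp h) n f⟫_ℝ =
      ((n + 1 : ℕ) : ℝ)⁻¹ * ∫ x, (∑ i, f (x i)) ^ 2 ∂(pathLaw P π n) := by
  rw [integral_sum_sq h, inner_fejerOp]
  simp only [centeredOp, deflate_pow_apply (markovOp_symmetric h) (markovOp_oneL2 h) hf]

/-- The bridge from chains to operators: variance ignores the mean, so `f` may be centred, and the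
variance becomes a second moment. -/
theorem evariance_average_pathLaw (h : P.IsReversible π) {f : S → ℝ} (hf : MemLp f 2 π) (n : ℕ)
    {f₀ : Lp ℝ 2 π} (hf₀ : f₀ = hf.toLp f - ⟪oneL2 π, hf.toLp f⟫_ℝ • oneL2 π) :
    ((n + 1 : ℕ) : ℝ≥0∞) *
      evariance (fun x : Fin (n + 1) → S => (∑ i, f (x i)) / ((n + 1 : ℕ) : ℝ)) (pathLaw P π n) =
    ENNReal.ofReal ⟪f₀, fejerOp (centeredOp h) n f₀⟫_ℝ := by
  set m := ⟪oneL2 π, hf.toLp f⟫_ℝ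
  have h0 : ⟪oneL2 π, f₀⟫_ℝ = 0 := by
    rw [hf₀, inner_sub_right, inner_smul_right, real_inner_self_eq_norm_sq, norm_oneL2]
    ring
  have hfae : ∀ᵐ x ∂π, f x = f₀ x + m := by
    have h1 : f₀ =ᵐ[π] ⇑(hf.toLp f) - ⇑(m • oneL2 π) := by
      rw [hf₀]; exact Lp.coeFn_sub (hf.toLp f) (m • oneL2 π)
    filter_upwards [h1, hf.coeFn_toLp, Lp.coeFn_smul m (oneL2 π), oneL2_ae_eq (π := π)]
      with x h1 h2 h3 h4
    rw [h1, Pi.sub_apply, h3, Pi.smul_apply, h2, h4]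
    simp
  set Y : (Fin (n + 1) → S) → ℝ := fun x => ((n + 1 : ℕ) : ℝ)⁻¹ * ∑ i, f₀ (x i) with hY
  have hYL : MemLp Y 2 (pathLaw P π n) := (memLp_sum_pathLaw h n (Lp.memLp f₀)).const_mul _
  have hae : (fun x : Fin (n + 1) → S => (∑ i, f (x i)) / ((n + 1 : ℕ) : ℝ)) =ᵐ[pathLaw P π n]
      fun x => Y x + m := by
    have : ∀ᵐ x ∂(pathLaw P π n), ∀ i, f (x i) = f₀ (x i) + m :=
      ae_all_iff.2 fun i => (measurePreserving_eval_pathLaw h n i).quasiMeasurePreserving.ae hfae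
    filter_upwards [this] with x hx
    simp only [hx, hY, Finset.sum_add_distrib, Finset.sum_const, Finset.card_univ, Fintype.card_fin,
      nsmul_eq_mul]
    field_simp
  have hYint : ∫ x, Y x ∂(pathLaw P π n) = 0 := by
    rw [hY, integral_const_mul, integral_finsetSum _ fun i _ => ?_]
    · refine mul_eq_zero_of_right _ (Finset.sum_eq_zero fun i _ => ?_)
      have hm := measurePreserving_eval_pathLaw (P := P) h n i
      have := integral_map hm.measurable.aemeasurable (f := f₀)
        (by rw [hm.map_eq]; exact Lp.aestronglyMeasurable f₀)
      rw [← this, hm.map_eq, ← inner_oneL2, h0]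
    · exact ((Lp.memLp f₀).comp_measurePreserving
        (measurePreserving_eval_pathLaw h n i)).integrable (by norm_num)
  have hYm : MemLp (fun x => Y x + m) 2 (pathLaw P π n) := hYL.add (memLp_const m)
  rw [evariance_congr hae, ← ofReal_variance hYm,
    variance_add_const hYL.aestronglyMeasurable, variance_of_integral_eq_zero hYL.aemeasurable hYint,
    ← ENNReal.ofReal_natCast, ← ENNReal.ofReal_mul (by positivity)]
  congr 1
  simp only [hY, mul_pow, integral_const_mul]
  rw [inner_fejerOp_centeredOp h h0]
  field_simp

end PathLaw

/-! ### Cheeger's inequality -/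

section Cheeger

open scoped InnerProductSpace

variable {S : Type*} [MeasurableSpace S]

/-- A kernel has positive conductance if the stationary flow out of each set of mass at most `1/2`
is at least a fixed fraction of the mass of the set. -/
def HasPositiveConductance (P : Kernel S S) (π : Measure S) : Prop :=
  ∃ κ : ℝ, 0 < κ ∧ ∀ A, MeasurableSet A → π A ≤ 1 / 2 →
    ENNReal.ofReal κ * π A ≤ ∫⁻ x in A, P x Aᶜ ∂π

/-- Take the infimum of the points where the distribution function reaches `1/2`: right continuity
gives one bound, the left limit the other. -/
lemma exists_median (π : Measure S) [IsProbabilityMeasure π] {f : S → ℝ} (hf : Measurable f) :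
    ∃ m, π {x | m < f x} ≤ 1 / 2 ∧ π {x | f x < m} ≤ 1 / 2 := by
  have hν : IsProbabilityMeasure (π.map f) := Measure.isProbabilityMeasure_map hf.aemeasurable
  set F := cdf (π.map f) with hF
  have hmono : Monotone F := monotone_cdf _
  set T := {t | 1 / 2 ≤ F t} with hT
  have hne : T.Nonempty :=
    ((tendsto_cdf_atTop (π.map f)).eventually_const_le (by norm_num : (1 / 2 : ℝ) < 1)).exists
  obtain ⟨b, hb⟩ :=
    ((tendsto_cdf_atBot (π.map f)).eventually_lt_const (by norm_num : (0 : ℝ) < 1 / 2)).exists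
  have hbdd : BddBelow T := ⟨b, fun t ht => by
    by_contra hlt
    have h1 : F t ≤ F b := hmono (not_le.1 hlt).le
    have h2 : 1 / 2 ≤ F t := ht
    linarith⟩
  refine ⟨sInf T, ?_, ?_⟩
  · have h1 : 1 / 2 ≤ F (sInf T) := by
      have hr : Tendsto F (𝓝[>] (sInf T)) (𝓝 (F (sInf T))) :=
        ((cdf (π.map f)).right_continuous (sInf T)).mono_left (nhdsWithin_mono _ Set.Ioi_subset_Ici_self)
      refine ge_of_tendsto hr ?_
      filter_upwards [self_mem_nhdsWithin] with t ht
      obtain ⟨s, hs, hst⟩ := exists_lt_of_csInf_lt hne ht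
      exact le_trans hs (hmono hst.le)
    have h2 : π {x | sInf T < f x} = π.map f (Set.Ioi (sInf T)) :=
      (Measure.map_apply hf measurableSet_Ioi).symm
    rw [h2, ← measure_cdf (π.map f), StieltjesFunction.measure_Ioi _ (tendsto_cdf_atTop _)]
    refine (ENNReal.ofReal_le_ofReal (by linarith : (1 : ℝ) - F (sInf T) ≤ 1 / 2)).trans ?_
    rw [ENNReal.ofReal_div_of_pos (by norm_num)]
    simp
  · have h1 : Function.leftLim F (sInf T) ≤ 1 / 2 := by
      refine le_of_tendsto (hmono.tendsto_leftLim _) ?_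
      filter_upwards [self_mem_nhdsWithin] with t ht
      by_contra hlt
      exact absurd (csInf_le hbdd (not_le.1 hlt).le : sInf T ≤ t) (not_le.2 ht)
    have h2 : π {x | f x < sInf T} = π.map f (Set.Iio (sInf T)) :=
      (Measure.map_apply hf measurableSet_Iio).symm
    rw [h2, ← measure_cdf (π.map f), StieltjesFunction.measure_Iio _ (tendsto_cdf_atBot _), sub_zero]
    refine (ENNReal.ofReal_le_ofReal h1).trans ?_
    rw [ENNReal.ofReal_div_of_pos (by norm_num)]
    simp

variable {P : Kernel S S} [IsMarkovKernel P] {π : Measure S} [IsProbabilityMeasure π]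

lemma compProd_prod_self_add {A : Set S} (hA : MeasurableSet A) :
    (π ⊗ₘ P) (A ×ˢ A) + ∫⁻ x in A, P x Aᶜ ∂π = π A := by
  rw [Measure.compProd_apply_prod hA hA, ← lintegral_add_left (P.measurable_coe hA)]
  simp [measure_add_measure_compl hA]

lemma integral_comp_fst_compProd {f : S → ℝ} (hf : AEStronglyMeasurable f π) :
    ∫ p, f p.1 ∂(π ⊗ₘ P) = ∫ x, f x ∂π := by
  have hm := measurePreserving_fst_compProd (P := P) (π := π)
  rw [← integral_map (f := f) hm.measurable.aemeasurable (by rwa [hm.map_eq]), hm.map_eq]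

lemma integral_comp_snd_compProd (h : P.IsReversible π) {f : S → ℝ}
    (hf : AEStronglyMeasurable f π) : ∫ p, f p.2 ∂(π ⊗ₘ P) = ∫ x, f x ∂π := by
  have hm := measurePreserving_snd_compProd h
  rw [← integral_map (f := f) hm.measurable.aemeasurable (by rwa [hm.map_eq]), hm.map_eq]

/-- Layer-cake argument: `{min (u x) (u y) > t}` is the square of the level set `{u > t}`, which for
`t > 0` has mass at most `1/2`, so conductance applies level by level. -/
lemma integral_min_add_le {κ : ℝ} (hκ0 : 0 < κ)
    (hκ : ∀ A, MeasurableSet A → π A ≤ 1 / 2 → ENNReal.ofReal κ * π A ≤ ∫⁻ x in A, P x Aᶜ ∂π)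
    {u : S → ℝ} (hu : Measurable u) (hu0 : ∀ x, 0 ≤ u x) (hui : Integrable u π)
    (hu2 : π {x | 0 < u x} ≤ 1 / 2) :
    ∫ p, min (u p.1) (u p.2) ∂(π ⊗ₘ P) + κ * ∫ x, u x ∂π ≤ ∫ x, u x ∂π := by
  have hmin : Measurable (fun p : S × S => min (u p.1) (u p.2)) := by fun_prop
  have hmin0 : ∀ p : S × S, 0 ≤ min (u p.1) (u p.2) := fun p => le_min (hu0 _) (hu0 _)
  have hmini : Integrable (fun p : S × S => min (u p.1) (u p.2)) (π ⊗ₘ P) := by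
    refine (measurePreserving_fst_compProd.integrable_comp_of_integrable hui).mono
      hmin.aestronglyMeasurable (.of_forall fun p => ?_)
    rw [Real.norm_of_nonneg (hmin0 p), Function.comp_apply, Real.norm_of_nonneg (hu0 _)]
    exact min_le_left _ _
  have key : ∫⁻ p, ENNReal.ofReal (min (u p.1) (u p.2)) ∂(π ⊗ₘ P) +
      ENNReal.ofReal κ * ∫⁻ x, ENNReal.ofReal (u x) ∂π ≤ ∫⁻ x, ENNReal.ofReal (u x) ∂π := by
    rw [lintegral_eq_lintegral_meas_lt _ (.of_forall hmin0) hmin.aemeasurable,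
      lintegral_eq_lintegral_meas_lt _ (.of_forall hu0) hu.aemeasurable]
    have hanti : Antitone fun t => π {x | t < u x} := fun s t hst =>
      measure_mono fun x hx => lt_of_le_of_lt hst hx
    rw [← lintegral_const_mul _ hanti.measurable,
      ← lintegral_add_right _ (hanti.measurable.const_mul _)]
    refine setLIntegral_mono hanti.measurable fun t ht => ?_
    have hA : MeasurableSet {x | t < u x} := measurableSet_lt measurable_const hu
    have hset : {p : S × S | t < min (u p.1) (u p.2)} = {x | t < u x} ×ˢ {x | t < u x} := by
      ext p; simp
    rw [hset, ← compProd_prod_self_add (P := P) hA]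
    gcongr
    rw [compProd_prod_self_add hA]
    have hsub : {x | t < u x} ⊆ {x | 0 < u x} := fun x hx =>
      show 0 < u x from lt_trans (Set.mem_Ioi.1 ht) hx
    exact hκ _ hA ((measure_mono hsub).trans hu2)
  rw [← ofReal_integral_eq_lintegral_ofReal hmini (.of_forall hmin0),
    ← ofReal_integral_eq_lintegral_ofReal hui (.of_forall hu0), ← ENNReal.ofReal_mul hκ0.le,
    ← ENNReal.ofReal_add (integral_nonneg hmin0) (mul_nonneg hκ0.le (integral_nonneg hu0))] at key
  exact (ENNReal.ofReal_le_ofReal_iff (integral_nonneg hu0)).1 key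

/-- Weighted AM-GM on `|a² - b²| = |a - b| (a + b)`. The weight is chosen so that, after
integration, the last term takes up only half of the gain `κ ∫ g²`. -/
lemma sq_add_sq_sub_min_le {κ : ℝ} (hκ0 : 0 < κ) {a b : ℝ} (ha : 0 ≤ a) (hb : 0 ≤ b) :
    (a ^ 2 + b ^ 2) / 2 ≤ min (a ^ 2) (b ^ 2) + ((a - b) ^ 2 / (2 * κ) + κ / 4 * (a ^ 2 + b ^ 2)) := by
  have h1 : ∀ a b : ℝ, 0 ≤ a → a ≤ b →
      (a ^ 2 + b ^ 2) / 2 ≤ a ^ 2 + ((a - b) ^ 2 / (2 * κ) + κ / 4 * (a ^ 2 + b ^ 2)) := by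
    intro a b ha hab
    have : (b - a) * (a + b) / 2 ≤ (a - b) ^ 2 / (2 * κ) + κ / 8 * (a + b) ^ 2 := by
      have e : (a - b) ^ 2 / (2 * κ) + κ / 8 * (a + b) ^ 2 - (b - a) * (a + b) / 2 =
          ((b - a) - κ / 2 * (a + b)) ^ 2 / (2 * κ) := by field_simp; ring
      have : 0 ≤ ((b - a) - κ / 2 * (a + b)) ^ 2 / (2 * κ) := by positivity
      linarith
    nlinarith [mul_nonneg hκ0.le (sq_nonneg (a - b))]
  rcases le_total a b with hab | hab
  · rw [min_eq_left (pow_le_pow_left₀ ha hab 2)]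
    exact h1 a b ha hab
  · rw [min_eq_right (pow_le_pow_left₀ hb hab 2)]
    have := h1 b a hb hab
    rw [add_comm (a ^ 2), ← neg_sub, neg_sq]
    exact this

lemma integrable_sq_sub_compProd (h : P.IsReversible π) {g : S → ℝ} (hg : MemLp g 2 π) :
    Integrable (fun p : S × S => (g p.1 - g p.2) ^ 2) (π ⊗ₘ P) :=
  ((hg.comp_measurePreserving measurePreserving_fst_compProd).sub
    (hg.comp_measurePreserving (measurePreserving_snd_compProd h))).integrable_sq

lemma cheeger_of_nonneg (h : P.IsReversible π) {κ : ℝ} (hκ0 : 0 < κ)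
    (hκ : ∀ A, MeasurableSet A → π A ≤ 1 / 2 → ENNReal.ofReal κ * π A ≤ ∫⁻ x in A, P x Aᶜ ∂π)
    {g : S → ℝ} (hgm : Measurable g) (hg : MemLp g 2 π) (hg0 : ∀ x, 0 ≤ g x)
    (hg2 : π {x | 0 < g x} ≤ 1 / 2) :
    κ ^ 2 * ∫ x, g x ^ 2 ∂π ≤ ∫ p, (g p.1 - g p.2) ^ 2 ∂(π ⊗ₘ P) := by
  have hgi : Integrable (fun x => g x ^ 2) π := hg.integrable_sq
  have h1 := integral_min_add_le hκ0 hκ (hgm.pow_const 2) (fun x => sq_nonneg (g x)) hgi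
    ((measure_mono fun x hx => lt_of_le_of_ne (hg0 x) fun h0 => by
      simp [← h0] at hx).trans hg2)
  have hi1 : Integrable (fun p : S × S => g p.1 ^ 2) (π ⊗ₘ P) :=
    measurePreserving_fst_compProd.integrable_comp_of_integrable hgi
  have hi2 : Integrable (fun p : S × S => g p.2 ^ 2) (π ⊗ₘ P) :=
    (measurePreserving_snd_compProd h).integrable_comp_of_integrable hgi
  have hD := integrable_sq_sub_compProd h hg
  have hmini : Integrable (fun p : S × S => min (g p.1 ^ 2) (g p.2 ^ 2)) (π ⊗ₘ P) := hi1.inf hi2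
  have hs : Integrable (fun p : S × S => g p.1 ^ 2 + g p.2 ^ 2) (π ⊗ₘ P) := hi1.add hi2
  have hsum : ∫ p, (g p.1 ^ 2 + g p.2 ^ 2) ∂(π ⊗ₘ P) = 2 * ∫ x, g x ^ 2 ∂π := by
    rw [integral_add hi1 hi2, integral_comp_fst_compProd (f := fun x => g x ^ 2) hgi.1,
      integral_comp_snd_compProd h (f := fun x => g x ^ 2) hgi.1]
    ring
  have hr : Integrable (fun p : S × S =>
      (g p.1 - g p.2) ^ 2 / (2 * κ) + κ / 4 * (g p.1 ^ 2 + g p.2 ^ 2)) (π ⊗ₘ P) :=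
    (hD.div_const _).add (hs.const_mul _)
  have h2 : ∫ p, (g p.1 ^ 2 + g p.2 ^ 2) / 2 ∂(π ⊗ₘ P) ≤ ∫ p, (min (g p.1 ^ 2) (g p.2 ^ 2) +
      ((g p.1 - g p.2) ^ 2 / (2 * κ) + κ / 4 * (g p.1 ^ 2 + g p.2 ^ 2))) ∂(π ⊗ₘ P) :=
    integral_mono (hs.div_const 2) (hmini.add hr) fun p =>
      sq_add_sq_sub_min_le hκ0 (hg0 p.1) (hg0 p.2)
  rw [integral_add hmini hr, integral_add (hD.div_const _) (hs.const_mul _), integral_div,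
    integral_div, integral_const_mul, hsum] at h2
  set D := ∫ p, (g p.1 - g p.2) ^ 2 ∂(π ⊗ₘ P)
  set G := ∫ x, g x ^ 2 ∂π
  have h3 : κ / 2 * G ≤ D / (2 * κ) := by linarith
  rw [le_div_iff₀ (by positivity)] at h3
  linarith

/-- Cheeger's inequality for reversible kernels. -/
theorem cheeger (h : P.IsReversible π) {κ : ℝ} (hκ0 : 0 < κ)
    (hκ : ∀ A, MeasurableSet A → π A ≤ 1 / 2 → ENNReal.ofReal κ * π A ≤ ∫⁻ x in A, P x Aᶜ ∂π)
    {f : S → ℝ} (hfm : Measurable f) (hf : MemLp f 2 π) :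
    κ ^ 2 * (∫ x, f x ^ 2 ∂π - (∫ x, f x ∂π) ^ 2) ≤ ∫ p, (f p.1 - f p.2) ^ 2 ∂(π ⊗ₘ P) := by
  -- Splitting at a median makes both the positive and the negative part of `f - m` live on mass at
  -- most `1/2`.
  obtain ⟨m, hm1, hm2⟩ := exists_median π hfm
  have hfm' : MemLp (fun x => f x - m) 2 π := hf.sub (memLp_const m)
  have hmf' : MemLp (fun x => m - f x) 2 π := (memLp_const m).sub hf
  have hp : MemLp (fun x => max (f x - m) 0) 2 π := hfm'.pos_part
  have hn : MemLp (fun x => max (m - f x) 0) 2 π := hmf'.pos_part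
  have h1 := cheeger_of_nonneg h hκ0 hκ (g := fun x => max (f x - m) 0) (by fun_prop) hp
    (fun x => le_max_right _ _) (by simpa using hm1)
  have h2 := cheeger_of_nonneg h hκ0 hκ (g := fun x => max (m - f x) 0) (by fun_prop) hn
    (fun x => le_max_right _ _) (by simpa using hm2)
  have hpn : ∀ x, max (f x - m) 0 ^ 2 + max (m - f x) 0 ^ 2 = (f x - m) ^ 2 := by
    intro x
    rcases le_total (f x) m with hx | hx
    · rw [max_eq_right (by linarith), max_eq_left (by linarith)]; ring
    · rw [max_eq_left (by linarith), max_eq_right (by linarith)]; ring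
  have h3 : ∫ p, (max (f p.1 - m) 0 - max (f p.2 - m) 0) ^ 2 ∂(π ⊗ₘ P) +
      ∫ p, (max (m - f p.1) 0 - max (m - f p.2) 0) ^ 2 ∂(π ⊗ₘ P) ≤
      ∫ p, (f p.1 - f p.2) ^ 2 ∂(π ⊗ₘ P) := by
    rw [← integral_add (integrable_sq_sub_compProd h hp) (integrable_sq_sub_compProd h hn)]
    refine integral_mono ((integrable_sq_sub_compProd h hp).add (integrable_sq_sub_compProd h hn))
      (integrable_sq_sub_compProd h hf) fun p => ?_
    rcases le_total (f p.1) m with hx | hx <;> rcases le_total (f p.2) m with hy | hy <;>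
      simp only [max_eq_left, max_eq_right, sub_nonneg, sub_nonpos, hx, hy] <;> nlinarith
  have h4 : ∫ x, max (f x - m) 0 ^ 2 ∂π + ∫ x, max (m - f x) 0 ^ 2 ∂π =
      ∫ x, f x ^ 2 ∂π - 2 * m * ∫ x, f x ∂π + m ^ 2 := by
    rw [← integral_add hp.integrable_sq hn.integrable_sq]
    simp_rw [hpn]
    have e : ∀ x, (f x - m) ^ 2 = f x ^ 2 - 2 * m * f x + m ^ 2 := fun x => by ring
    simp_rw [e]
    have hfi : Integrable f π := hf.integrable (by norm_num)
    have hsub : Integrable (fun x => f x ^ 2 - 2 * m * f x) π :=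
      hf.integrable_sq.sub (hfi.const_mul _)
    rw [integral_add hsub (integrable_const _),
      integral_sub hf.integrable_sq (hfi.const_mul _), integral_const_mul]
    simp
  -- The mean minimizes `∫ (f - m)²`, so replacing it by the median only helps.
  have h5 : κ ^ 2 * (∫ x, f x ^ 2 ∂π - (∫ x, f x ∂π) ^ 2) ≤
      κ ^ 2 * (∫ x, f x ^ 2 ∂π - 2 * m * ∫ x, f x ∂π + m ^ 2) := by
    gcongr
    nlinarith [sq_nonneg (∫ x, f x ∂π - m)]
  rw [← h4] at h5
  linarith

end Cheeger

/-! ### Variance bounding and conductance -/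

section Conductance

open scoped InnerProductSpace

variable {S : Type*} [MeasurableSpace S] {P : Kernel S S} [IsMarkovKernel P] {π : Measure S}
  [IsProbabilityMeasure π]

lemma centeredOp_symmetric (h : P.IsReversible π) (f g : Lp ℝ 2 π) :
    ⟪f, centeredOp h g⟫_ℝ = ⟪centeredOp h f, g⟫_ℝ :=
  deflate_symmetric (markovOp_symmetric h) _ _ _

lemma norm_centeredOp_apply_le (h : P.IsReversible π) (f : Lp ℝ 2 π) : ‖centeredOp h f‖ ≤ ‖f‖ :=
  norm_deflate_apply_le (norm_markovOp_apply_le h) norm_oneL2 (markovOp_oneL2 h) f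

omit [IsProbabilityMeasure π] in
lemma inner_self_Lp (f : Lp ℝ 2 π) : ⟪f, f⟫_ℝ = ∫ x, f x ^ 2 ∂π := by
  rw [L2.inner_def]
  exact integral_congr_ae (.of_forall fun x => (pow_two (f x)).symm)

lemma inner_sub_markovOp (h : P.IsReversible π) (f : Lp ℝ 2 π) :
    2 * ⟪f, f - markovOp h f⟫_ℝ = ∫ p, (f p.1 - f p.2) ^ 2 ∂(π ⊗ₘ P) := by
  have hf := Lp.memLp f
  have hi := hf.integrable_sq
  have hi1 : Integrable (fun p : S × S => f p.1 ^ 2) (π ⊗ₘ P) :=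
    measurePreserving_fst_compProd.integrable_comp_of_integrable hi
  have hi2 : Integrable (fun p : S × S => f p.2 ^ 2) (π ⊗ₘ P) :=
    (measurePreserving_snd_compProd h).integrable_comp_of_integrable hi
  have hm := (integrable_mul_compProd h hf hf).const_mul 2
  have hs : Integrable (fun p : S × S => f p.1 ^ 2 + f p.2 ^ 2) (π ⊗ₘ P) := hi1.add hi2
  have e : ∀ p : S × S, (f p.1 - f p.2) ^ 2 = f p.1 ^ 2 + f p.2 ^ 2 - 2 * (f p.1 * f p.2) :=
    fun p => by ring
  simp_rw [e]
  rw [integral_sub hs hm, integral_add hi1 hi2, integral_const_mul,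
    integral_comp_fst_compProd (f := fun x => f x ^ 2) hi.1,
    integral_comp_snd_compProd h (f := fun x => f x ^ 2) hi.1, inner_sub_right, inner_self_Lp,
    inner_markovOp]
  ring

theorem isVarianceBounding_of_hasPositiveConductance (h : P.IsReversible π)
    (hc : HasPositiveConductance P π) : IsVarianceBounding P π := by
  obtain ⟨κ, hκ0, hκ⟩ := hc
  intro f hf
  -- Cheeger gives `κ² / 2` orthogonally to the constants; on the constants `centeredOp` vanishes,
  -- which gives `1`.
  have hcoer : ∀ g : Lp ℝ 2 π, min (κ ^ 2 / 2) 1 * ‖g‖ ^ 2 ≤ ⟪g, g - centeredOp h g⟫_ℝ := by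
    intro g
    have h1 := cheeger h hκ0 hκ (Lp.stronglyMeasurable g).measurable (Lp.memLp g)
    rw [← inner_sub_markovOp h, ← inner_self_Lp, ← inner_oneL2, real_inner_self_eq_norm_sq] at h1
    have h2 : ⟪g, g - centeredOp h g⟫_ℝ = ⟪g, g - markovOp h g⟫_ℝ + ⟪oneL2 π, g⟫_ℝ ^ 2 := by
      rw [centeredOp, deflate_apply, inner_sub_right, inner_sub_right, inner_sub_right,
        inner_smul_right, real_inner_comm (oneL2 π)]
      ring
    have h3 : ⟪oneL2 π, g⟫_ℝ ^ 2 ≤ ‖g‖ ^ 2 := by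
      have := abs_real_inner_le_norm (oneL2 π) g
      rw [norm_oneL2, one_mul] at this
      exact sq_le_sq.2 (by rwa [abs_of_nonneg (norm_nonneg g)])
    have h4 := min_le_left (κ ^ 2 / 2) 1
    have h5 := min_le_right (κ ^ 2 / 2) 1
    rw [h2]
    nlinarith [sq_nonneg ⟪oneL2 π, g⟫_ℝ]
  obtain ⟨v, hv⟩ := tendsto_inner_fejerOp_of_coercive (centeredOp_symmetric h)
    (norm_centeredOp_apply_le h) (by positivity) hcoer
    (hf.toLp f - ⟪oneL2 π, hf.toLp f⟫_ℝ • oneL2 π)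
  refine ⟨ENNReal.ofReal v, ENNReal.ofReal_lt_top, ?_⟩
  rw [IsAsymptoticVariance]
  simp_rw [evariance_average_pathLaw h hf _ rfl]
  exact ENNReal.tendsto_ofReal hv

lemma exists_abs_inner_fejerOp_le (h : P.IsReversible π) (hv : IsVarianceBounding P π)
    (f : Lp ℝ 2 π) : ∃ C, ∀ n, |⟪f, fejerOp (centeredOp h) n f⟫_ℝ| ≤ C := by
  obtain ⟨v, hv1, hv2⟩ := hv f (Lp.memLp f)
  rw [IsAsymptoticVariance] at hv2
  simp_rw [evariance_average_pathLaw h (Lp.memLp f) _ rfl, Lp.toLp_coeFn] at hv2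
  set f₀ := f - ⟪oneL2 π, f⟫_ℝ • oneL2 π with hf₀
  have h0 : ⟪oneL2 π, f₀⟫_ℝ = 0 := by
    rw [hf₀, inner_sub_right, inner_smul_right, real_inner_self_eq_norm_sq, norm_oneL2]
    ring
  -- Being second moments, these forms are not truncated by `ENNReal.ofReal`.
  have hnn : ∀ n, 0 ≤ ⟪f₀, fejerOp (centeredOp h) n f₀⟫_ℝ := fun n => by
    rw [inner_fejerOp_centeredOp h h0]
    exact mul_nonneg (by positivity) (integral_nonneg fun x => sq_nonneg _)
  have hreal := (ENNReal.tendsto_toReal hv1.ne).comp hv2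
  obtain ⟨C, hC⟩ := hreal.bddAbove_range
  refine ⟨⟪oneL2 π, f⟫_ℝ ^ 2 + C, fun n => ?_⟩
  have hn : ⟪f₀, fejerOp (centeredOp h) n f₀⟫_ℝ ≤ C := by
    have := hC ⟨n, rfl⟩
    rwa [Function.comp_apply, ENNReal.toReal_ofReal (hnn n)] at this
  rw [inner_fejerOp_of_apply_eq_zero (centeredOp_symmetric h) norm_oneL2
    (deflate_self_apply norm_oneL2 (markovOp_oneL2 h)), abs_of_nonneg
    (add_nonneg (sq_nonneg _) (hnn n))]
  linarith

/-- Test coercivity on the centred indicator of `A`: its Dirichlet form is the flow out of `A`, and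
its squared norm `a - a²` is at least `a / 2` when `a ≤ 1/2`. -/
theorem hasPositiveConductance_of_isVarianceBounding (h : P.IsReversible π)
    (hv : IsVarianceBounding P π) : HasPositiveConductance P π := by
  obtain ⟨c, hc, hcoer⟩ := coercive_of_fejerOp_bounded (centeredOp_symmetric h)
    (norm_centeredOp_apply_le h) (exists_abs_inner_fejerOp_le h hv)
  refine ⟨c / 2, by positivity, fun A hA hA2 => ?_⟩
  set f : Lp ℝ 2 π := indicatorConstLp 2 hA (measure_ne_top π A) (1 : ℝ) with hf
  have hfae : f =ᵐ[π] A.indicator fun _ => 1 := indicatorConstLp_coeFn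
  set a := π.real A with ha
  have ha0 : 0 ≤ a := measureReal_nonneg
  have ha2 : a ≤ 1 / 2 := by
    have := ENNReal.toReal_mono (by norm_num) hA2
    simpa [ha, Measure.real] using this
  have h1f : ⟪oneL2 π, f⟫_ℝ = a := by
    rw [inner_oneL2, integral_congr_ae hfae, integral_indicator_const _ hA]
    simp [ha]
  have hff : ⟪f, f⟫_ℝ = a := by
    rw [hf, L2.inner_indicatorConstLp_one, ← hf, setIntegral_congr_ae (g := fun _ => (1 : ℝ)) hA]
    · simp [ha]
    · filter_upwards [hfae] with x hx hxA
      rw [hx, Set.indicator_of_mem hxA]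
  have hfP : ⟪f, markovOp h f⟫_ℝ = (π ⊗ₘ P).real (A ×ˢ A) := by
    rw [inner_markovOp, ← integral_indicator_one (hA.prod hA)]
    refine integral_congr_ae ?_
    filter_upwards [measurePreserving_fst_compProd.quasiMeasurePreserving.ae_eq_comp hfae,
      (measurePreserving_snd_compProd h).quasiMeasurePreserving.ae_eq_comp hfae] with p h1 h2
    simp only [Function.comp_apply] at h1 h2
    rw [h1, h2]
    by_cases hp1 : p.1 ∈ A <;> by_cases hp2 : p.2 ∈ A <;> simp [Set.indicator, hp1, hp2]
  have hflow : a - (π ⊗ₘ P).real (A ×ˢ A) = (∫⁻ x in A, P x Aᶜ ∂π).toReal := by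
    have h1 := compProd_prod_self_add (P := P) (π := π) hA
    have hne : ∫⁻ x in A, P x Aᶜ ∂π ≠ ∞ := fun htop => by
      rw [htop, add_top] at h1
      exact measure_ne_top π A h1.symm
    rw [ha, Measure.real, ← h1, ENNReal.toReal_add (measure_ne_top _ _) hne, Measure.real]
    ring
  have hone : ⟪f, markovOp h (oneL2 π)⟫_ℝ = a := by rw [markovOp_oneL2, real_inner_comm, h1f]
  have honeP : ⟪oneL2 π, markovOp h f⟫_ℝ = a := by
    rw [markovOp_symmetric, markovOp_oneL2, h1f]
  have key := hcoer (f - a • oneL2 π)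
  have h0 : ⟪oneL2 π, f - a • oneL2 π⟫_ℝ = 0 := by
    rw [inner_sub_right, inner_smul_right, real_inner_self_eq_norm_sq, norm_oneL2, h1f]
    ring
  have hnorm : ‖f - a • oneL2 π‖ ^ 2 = a - a ^ 2 := by
    rw [← real_inner_self_eq_norm_sq, inner_sub_left, inner_smul_left, h0, inner_sub_right,
      inner_smul_right, hff, real_inner_comm, h1f]
    simp
    ring
  have hE : ⟪f - a • oneL2 π, f - a • oneL2 π - centeredOp h (f - a • oneL2 π)⟫_ℝ =
      a - (π ⊗ₘ P).real (A ×ˢ A) := by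
    rw [centeredOp, deflate_apply, h0, zero_smul, sub_zero, map_sub, map_smul, markovOp_oneL2,
      sub_sub_sub_cancel_right, inner_sub_left, inner_smul_left, inner_sub_right, inner_sub_right,
      hff, h1f, honeP, hfP]
    simp
  rw [hnorm, hE, hflow] at key
  have hne : ∫⁻ x in A, P x Aᶜ ∂π ≠ ∞ := fun htop => by
    have h1 := compProd_prod_self_add (P := P) (π := π) hA
    rw [htop, add_top] at h1
    exact measure_ne_top π A h1.symm
  rw [← ENNReal.ofReal_toReal hne, ← ENNReal.ofReal_toReal (measure_ne_top π A),
    ← ENNReal.ofReal_mul (by positivity)]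
  refine ENNReal.ofReal_le_ofReal (le_trans ?_ key)
  change c / 2 * a ≤ _
  nlinarith [mul_nonneg hc.le ha0]

end Conductance

/-! ### Propose-accept-reject kernels -/

section ProposeAcceptReject

variable {S : Type*} [MeasurableSpace S] {μ : Measure S} [SFinite μ] {q α : S → S → ℝ}

lemma measurable_ofReal_mul (hq : Measurable (Function.uncurry q))
    (hα : Measurable (Function.uncurry α)) :
    Measurable (Function.uncurry fun x y => ENNReal.ofReal (q x y * α x y)) :=
  (hq.mul hα).ennreal_ofReal

lemma measurable_reject (hq : Measurable (Function.uncurry q))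
    (hα : Measurable (Function.uncurry α)) :
    Measurable fun x => 1 - ∫⁻ z, ENNReal.ofReal (q x z * α x z) ∂μ :=
  measurable_const.sub (measurable_ofReal_mul hq hα).lintegral_prod_right

lemma proposeAcceptReject_apply (hq : Measurable (Function.uncurry q))
    (hα : Measurable (Function.uncurry α)) (x : S) {B : Set S} (hB : MeasurableSet B) :
    proposeAcceptReject μ q α x B = ∫⁻ y in B, ENNReal.ofReal (q x y * α x y) ∂μ +
      B.indicator (fun x => 1 - ∫⁻ z, ENNReal.ofReal (q x z * α x z) ∂μ) x := by
  classical
  have hr : Measurable (Function.uncurry fun (x : S) (_ : S) =>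
      1 - ∫⁻ z, ENNReal.ofReal (q x z * α x z) ∂μ) := (measurable_reject hq hα).comp measurable_fst
  rw [proposeAcceptReject, add_apply, Measure.add_apply,
    Kernel.withDensity_apply' _ (measurable_ofReal_mul hq hα),
    Kernel.withDensity_apply' _ hr, Kernel.const_apply,
    Kernel.id_apply, setLIntegral_dirac' measurable_const hB]
  rfl

-- Ensures that the truncated subtraction in the rejection mass is exact.
omit [SFinite μ] in
lemma lintegral_accept_le_one (hq : IsProposalDensity μ q) (hα1 : ∀ x y, α x y ≤ 1) (x : S) :
    ∫⁻ z, ENNReal.ofReal (q x z * α x z) ∂μ ≤ 1 := by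
  rw [← hq.lintegral_eq_one x]
  exact lintegral_mono fun z => ENNReal.ofReal_le_ofReal
    (mul_le_of_le_one_right (hq.nonneg x z) (hα1 x z))

lemma isMarkovKernel_proposeAcceptReject (hq : IsProposalDensity μ q)
    (hα : Measurable (Function.uncurry α)) (hα1 : ∀ x y, α x y ≤ 1) :
    IsMarkovKernel (proposeAcceptReject μ q α) := by
  refine ⟨fun x => ⟨?_⟩⟩
  rw [proposeAcceptReject_apply hq.measurable hα x MeasurableSet.univ, setLIntegral_univ,
    Set.indicator_univ]
  exact add_tsub_cancel_of_le (lintegral_accept_le_one hq hα1 x)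

/-- Detailed balance and Tonelli handle the accepted moves; rejections stay on the diagonal and
contribute a term over `A ∩ B`, symmetric in the two sets. -/
lemma isReversible_proposeAcceptReject {p : S → ℝ} (hp : Measurable p) (hp0 : ∀ x, 0 ≤ p x)
    (hq : Measurable (Function.uncurry q)) (hα : Measurable (Function.uncurry α))
    (hsymm : ∀ x y, p x * (q x y * α x y) = p y * (q y x * α y x)) :
    (proposeAcceptReject μ q α).IsReversible (μ.withDensity fun x => ENNReal.ofReal (p x)) := by
  have hp' : Measurable fun x => ENNReal.ofReal (p x) := hp.ennreal_ofReal
  have hm := measurable_ofReal_mul hq hα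
  have key : ∀ {A B : Set S}, MeasurableSet A → MeasurableSet B →
      ∫⁻ x in A, proposeAcceptReject μ q α x B ∂(μ.withDensity fun x => ENNReal.ofReal (p x)) =
        ∫⁻ x in A, ∫⁻ y in B, ENNReal.ofReal (p x * (q x y * α x y)) ∂μ ∂μ +
        ∫⁻ x in A ∩ B, ENNReal.ofReal (p x) *
          (1 - ∫⁻ z, ENNReal.ofReal (q x z * α x z) ∂μ) ∂μ := by
    intro A B hA hB
    have hind : Measurable (B.indicator fun x => ENNReal.ofReal (p x) *
        (1 - ∫⁻ z, ENNReal.ofReal (q x z * α x z) ∂μ)) :=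
      (hp'.mul (measurable_reject hq hα)).indicator hB
    rw [setLIntegral_withDensity_eq_setLIntegral_mul _ hp' (Kernel.measurable_coe _ hB) hA,
      Set.inter_comm, ← Measure.restrict_restrict hB,
      ← lintegral_indicator hB, ← lintegral_add_right _ hind]
    refine lintegral_congr fun x => ?_
    rw [Pi.mul_apply, proposeAcceptReject_apply hq hα x hB, mul_add]
    congr 1
    · have hmx : Measurable fun y => ENNReal.ofReal (q x y * α x y) :=
        hm.comp measurable_prodMk_left
      rw [← lintegral_const_mul _ hmx]
      exact lintegral_congr fun y => (ENNReal.ofReal_mul (hp0 x)).symm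
    · by_cases hx : x ∈ B <;> simp [hx]
  intro A B hA hB
  rw [key hA hB, key hB hA, Set.inter_comm A B, lintegral_lintegral_swap]
  · simp_rw [hsymm]
  · have : Measurable fun z : S × S => ENNReal.ofReal (p z.1 * (q z.1 z.2 * α z.1 z.2)) :=
      ((hp.comp measurable_fst).mul (hq.mul hα)).ennreal_ofReal
    exact this.aemeasurable

/-- Positive conductance passes from one propose-accept-reject kernel to another with the same
proposal, if the acceptance probabilities of the second are bounded below by a multiple of those of
the first up to an arbitrarily small amount of proposal mass. -/
theorem hasPositiveConductance_of_accept_le {α' : S → S → ℝ} {ν : Measure S} [IsFiniteMeasure ν]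
    (hq : IsProposalDensity μ q) (hα : Measurable (Function.uncurry α))
    (hα' : Measurable (Function.uncurry α')) (hα1 : ∀ x y, α x y ≤ 1)
    (hcomp : ∀ ε : ℝ, 0 < ε → ∃ c : ℝ, 0 < c ∧ ∀ᵐ x ∂ν,
      ∫⁻ y in {y | α' x y < c * α x y}, ENNReal.ofReal (q x y) ∂μ ≤ ENNReal.ofReal ε)
    (h : HasPositiveConductance (proposeAcceptReject μ q α) ν) :
    HasPositiveConductance (proposeAcceptReject μ q α') ν := by
  obtain ⟨κ, hκ0, hκ⟩ := h
  -- Exceptional proposals may then consume at most half of the guaranteed flow.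
  obtain ⟨c, hc0, hc⟩ := hcomp (κ / 2) (by positivity)
  refine ⟨c * (κ / 2), by positivity, fun A hA hA2 => ?_⟩
  have hstep : ∀ᵐ x ∂ν, x ∈ A → ENNReal.ofReal c * proposeAcceptReject μ q α x Aᶜ ≤
      proposeAcceptReject μ q α' x Aᶜ + ENNReal.ofReal (c * (κ / 2)) := by
    filter_upwards [hc] with x hx hxA
    have hqx : Measurable (q x) := hq.measurable.comp measurable_prodMk_left
    have hαx : Measurable (α x) := hα.comp measurable_prodMk_left
    have hαx' : Measurable (α' x) := hα'.comp measurable_prodMk_left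
    have hqα : Measurable fun y => ENNReal.ofReal (q x y * α x y) := (hqx.mul hαx).ennreal_ofReal
    have hqα' : Measurable fun y => ENNReal.ofReal (q x y * α' x y) :=
      (hqx.mul hαx').ennreal_ofReal
    have hE : MeasurableSet {y | α' x y < c * α x y} :=
      measurableSet_lt hαx' (hαx.const_mul c)
    -- As `x ∈ A`, rejection contributes nothing to the mass of `Aᶜ`.
    rw [proposeAcceptReject_apply hq.measurable hα x hA.compl,
      proposeAcceptReject_apply hq.measurable hα' x hA.compl, Set.indicator_of_notMem (by simpa),
      Set.indicator_of_notMem (by simpa), add_zero, add_zero,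
      ← lintegral_const_mul _ hqα, ENNReal.ofReal_mul hc0.le]
    have hpt : ∀ y, ENNReal.ofReal c * ENNReal.ofReal (q x y * α x y) ≤
        ENNReal.ofReal (q x y * α' x y) + {y | α' x y < c * α x y}.indicator
          (fun y => ENNReal.ofReal c * ENNReal.ofReal (q x y)) y := by
      intro y
      by_cases hy : α' x y < c * α x y
      · rw [Set.indicator_of_mem (s := {y | α' x y < c * α x y}) hy]
        refine le_add_left (mul_le_mul_right (ENNReal.ofReal_le_ofReal ?_) _)
        exact mul_le_of_le_one_right (hq.nonneg x y) (hα1 x y)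
      · refine le_add_right ?_
        rw [← ENNReal.ofReal_mul hc0.le]
        refine ENNReal.ofReal_le_ofReal ?_
        rw [mul_left_comm]
        exact mul_le_mul_of_nonneg_left (not_lt.1 hy) (hq.nonneg x y)
    refine (lintegral_mono hpt).trans ?_
    rw [lintegral_add_left hqα']
    gcongr
    refine (setLIntegral_le_lintegral _ _).trans ?_
    rw [lintegral_indicator hE, lintegral_const_mul _ hqx.ennreal_ofReal]
    gcongr
  have h1 : ENNReal.ofReal c * ∫⁻ x in A, proposeAcceptReject μ q α x Aᶜ ∂ν ≤
      ∫⁻ x in A, proposeAcceptReject μ q α' x Aᶜ ∂ν + ENNReal.ofReal (c * (κ / 2)) * ν A := by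
    rw [← lintegral_const_mul _ (Kernel.measurable_coe _ hA.compl), ← setLIntegral_const,
      ← lintegral_add_right _ measurable_const]
    exact lintegral_mono_ae ((ae_restrict_iff' hA).2 hstep)
  have h2 : ENNReal.ofReal (c * (κ / 2)) * ν A + ENNReal.ofReal (c * (κ / 2)) * ν A ≤
      ENNReal.ofReal c * ∫⁻ x in A, proposeAcceptReject μ q α x Aᶜ ∂ν := by
    rw [← add_mul, ← ENNReal.ofReal_add (by positivity) (by positivity), ← mul_add, add_halves,
      ENNReal.ofReal_mul hc0.le, mul_assoc]
    gcongr
    exact hκ A hA hA2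
  exact ENNReal.le_of_add_le_add_right (ENNReal.mul_ne_top ENNReal.ofReal_ne_top
    (measure_ne_top ν A)) (h2.trans h1)

end ProposeAcceptReject

/-! ### Comparison of the acceptance probabilities -/

section Acceptance

variable {S : Type*} {π π' : S → ℝ} {q : S → S → ℝ}

lemma acceptMH_le_one (x y : S) : acceptMH π q x y ≤ 1 := min_le_left _ _

lemma acceptDA_le_one (x y : S) (h2 : 0 ≤ ratioDA₂ π π' x y) : acceptDA π π' q x y ≤ 1 :=
  mul_le_one₀ (min_le_left _ _) (le_min zero_le_one h2) (min_le_left _ _)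

lemma ratioMH_nonneg (hπ : ∀ x, 0 < π x) (hq : ∀ x y, 0 ≤ q x y) (x y : S) :
    0 ≤ ratioMH π q x y :=
  div_nonneg (mul_nonneg (hπ y).le (hq y x)) (mul_nonneg (hπ x).le (hq x y))

lemma ratioDA₂_pos (hπ : ∀ x, 0 < π x) (hπ' : ∀ x, 0 < π' x) (x y : S) :
    0 < ratioDA₂ π π' x y :=
  div_pos (div_pos (hπ y) (hπ' y)) (div_pos (hπ x) (hπ' x))

lemma acceptDA_nonneg (hπ : ∀ x, 0 < π x) (hπ' : ∀ x, 0 < π' x) (hq : ∀ x y, 0 ≤ q x y) (x y : S) :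
    0 ≤ acceptDA π π' q x y :=
  mul_nonneg (le_min zero_le_one (ratioMH_nonneg hπ' hq x y))
    (le_min zero_le_one (ratioDA₂_pos hπ hπ' x y).le)

/-- Exhibits accepted flow as a symmetric minimum; the case `a = 0` survives because `b ≥ 0`. -/
lemma mul_min_one_div {a b : ℝ} (ha : 0 ≤ a) (hb : 0 ≤ b) : a * min 1 (b / a) = min a b := by
  rcases ha.eq_or_lt with rfl | ha
  · simp [hb]
  · rw [mul_min_of_nonneg _ _ ha.le, mul_one, mul_div_cancel₀ _ ha.ne']

lemma acceptMH_symm (hπ : ∀ x, 0 < π x) (hq : ∀ x y, 0 ≤ q x y) (x y : S) :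
    π x * (q x y * acceptMH π q x y) = π y * (q y x * acceptMH π q y x) := by
  rw [← mul_assoc, ← mul_assoc, acceptMH, acceptMH, ratioMH, ratioMH,
    mul_min_one_div (mul_nonneg (hπ x).le (hq x y)) (mul_nonneg (hπ y).le (hq y x)),
    mul_min_one_div (mul_nonneg (hπ y).le (hq y x)) (mul_nonneg (hπ x).le (hq x y)), min_comm]

/-- Each stage balances separately: screening with respect to `π'`, correction with respect to the
weight `π / π'`. -/
lemma acceptDA_symm (hπ : ∀ x, 0 < π x) (hπ' : ∀ x, 0 < π' x) (hq : ∀ x y, 0 ≤ q x y) (x y : S) :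
    π x * (q x y * acceptDA π π' q x y) = π y * (q y x * acceptDA π π' q y x) := by
  have e : ∀ x y, π x * (q x y * acceptDA π π' q x y) =
      (π' x * (q x y * acceptMH π' q x y)) * ((π x / π' x) * min 1 (ratioDA₂ π π' x y)) := by
    intro x y
    have := (hπ' x).ne'
    rw [acceptDA, acceptMH]
    field_simp
  rw [e, e, acceptMH_symm hπ' hq, ratioDA₂, ratioDA₂,
    mul_min_one_div (div_pos (hπ x) (hπ' x)).le (div_pos (hπ y) (hπ' y)).le,
    mul_min_one_div (div_pos (hπ y) (hπ' y)).le (div_pos (hπ x) (hπ' x)).le, min_comm (π x / π' x)]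

lemma ratioMH_eq_mul (hπ : ∀ x, 0 < π x) (hπ' : ∀ x, 0 < π' x) (x y : S) :
    ratioMH π q x y = ratioMH π' q x y * ratioDA₂ π π' x y := by
  have h1 := (hπ x).ne'
  have h2 := (hπ' x).ne'
  have h3 := (hπ' y).ne'
  rw [ratioMH, ratioMH, ratioDA₂]
  field_simp

/-- A loss can occur only when one ratio is below `1` and the other above; the sign condition
excludes this. -/
lemma acceptMH_le_acceptDA_of_mem_noProblemSet (hπ : ∀ x, 0 < π x) (hπ' : ∀ x, 0 < π' x)
    {x y : S} (hxy : 0 < q x y) (hyx : 0 < q y x) (hy : y ∈ noProblemSet π π' q x) :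
    acceptMH π q x y ≤ acceptDA π π' q x y := by
  have h1 : 0 < ratioMH π' q x y := div_pos (mul_pos (hπ' y) hyx) (mul_pos (hπ' x) hxy)
  have h2 := ratioDA₂_pos hπ hπ' x y
  rw [acceptMH, acceptDA, ratioMH_eq_mul hπ hπ']
  simp only [noProblemSet, Set.mem_ofPred_eq] at hy
  set r₁ := ratioMH π' q x y
  set r₂ := ratioDA₂ π π' x y
  rcases lt_or_ge r₁ 1 with h | h <;> rcases lt_or_ge r₂ 1 with h' | h'
  · rw [min_eq_right h.le, min_eq_right h'.le]; exact min_le_right _ _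
  · rcases h'.eq_or_lt with h'' | h''
    · rw [← h'', min_self, mul_one, mul_one]
    · rw [Real.sign_of_neg (Real.log_neg h1 h), Real.sign_of_pos (Real.log_pos h'')] at hy
      norm_num at hy
  · rcases h.eq_or_lt with h'' | h''
    · rw [← h'', min_self, one_mul, one_mul]
    · rw [Real.sign_of_neg (Real.log_neg h2 h'), Real.sign_of_pos (Real.log_pos h'')] at hy
      norm_num at hy
  · rw [min_eq_left h, min_eq_left h', mul_one]; exact min_le_left _ _

lemma acceptMH_eq_zero {x y : S} (h : q x y = 0 ∨ q y x = 0) : acceptMH π q x y = 0 := by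
  rcases h with h | h <;> simp [acceptMH, ratioMH, h]

lemma exp_neg_le_div_le_exp {H : ℝ} {x y : S} (hxy : 0 < q x y) (hyx : 0 < q y x)
    (hH : |logProposalRatio q x y| ≤ H) :
    Real.exp (-H) ≤ q y x / q x y ∧ q y x / q x y ≤ Real.exp H := by
  have e : q y x / q x y = Real.exp (logProposalRatio q x y) := by
    rw [logProposalRatio, Real.exp_sub, Real.exp_log hxy, Real.exp_log hyx]
  rw [e]
  exact ⟨Real.exp_le_exp.2 (abs_le.1 hH).1, Real.exp_le_exp.2 (abs_le.1 hH).2⟩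

lemma ratioMH_eq_div_mul (x y : S) : ratioMH π' q x y = π' y / π' x * (q y x / q x y) :=
  mul_div_mul_comm _ _ _ _

/-- Heavy tails put `π' y / π' x` and `r₂` on the same side of `1`, and `r₁` differs from the former
by a factor in `[exp (-H), exp H]`. -/
lemma acceptMH_le_acceptDA_of_heavy (hπ : ∀ x, 0 < π x) (hπ' : ∀ x, 0 < π' x)
    {H : ℝ} (hH0 : 0 ≤ H) {x y : S} (hxy : 0 < q x y) (hyx : 0 < q y x)
    (hH : |logProposalRatio q x y| ≤ H) (h1 : π' x ≤ π' y → π' y / π y ≤ π' x / π x)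
    (h2 : π' y ≤ π' x → π' x / π x ≤ π' y / π y) :
    Real.exp (-H) * acceptMH π q x y ≤ acceptDA π π' q x y := by
  obtain ⟨hl, hu⟩ := exp_neg_le_div_le_exp hxy hyx hH
  have ht : 0 < q y x / q x y := div_pos hyx hxy
  have hr2 := ratioDA₂_pos hπ hπ' x y
  have he1 : Real.exp (-H) ≤ 1 := Real.exp_le_one_iff.2 (by linarith)
  have he0 := Real.exp_pos (-H)
  have hinv : Real.exp (-H) * Real.exp H = 1 := by rw [← Real.exp_add]; simp
  have hflip : ∀ z, π z / π' z = (π' z / π z)⁻¹ := fun z => (inv_div _ _).symm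
  rcases le_total (π' x) (π' y) with h | h
  · have hr1 : Real.exp (-H) ≤ ratioMH π' q x y := by
      rw [ratioMH_eq_div_mul]
      exact hl.trans (le_mul_of_one_le_left ht.le ((one_le_div (hπ' x)).2 h))
    have hr2' : 1 ≤ ratioDA₂ π π' x y := by
      rw [ratioDA₂, one_le_div (div_pos (hπ x) (hπ' x)), hflip, hflip]
      exact inv_anti₀ (div_pos (hπ' y) (hπ y)) (h1 h)
    rw [acceptDA, min_eq_left hr2', mul_one]
    exact (mul_le_of_le_one_right he0.le (acceptMH_le_one x y)).trans (le_min he1 hr1)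
  · have hr1 : ratioMH π' q x y ≤ Real.exp H := by
      rw [ratioMH_eq_div_mul]
      exact (mul_le_of_le_one_left ht.le ((div_le_one (hπ' x)).2 h)).trans hu
    have hr10 : 0 ≤ ratioMH π' q x y := by
      rw [ratioMH_eq_div_mul]
      exact mul_nonneg (div_pos (hπ' y) (hπ' x)).le ht.le
    have hr2' : ratioDA₂ π π' x y ≤ 1 := by
      rw [ratioDA₂, div_le_one (div_pos (hπ x) (hπ' x)), hflip, hflip]
      exact inv_anti₀ (div_pos (hπ' x) (hπ x)) (h2 h)
    rw [acceptDA, min_eq_right hr2', acceptMH, ratioMH_eq_mul hπ hπ']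
    have hmin : Real.exp (-H) * ratioMH π' q x y ≤ min 1 (ratioMH π' q x y) := by
      refine le_min ?_ (mul_le_of_le_one_left hr10 he1)
      rw [← hinv]
      gcongr
    calc _ ≤ Real.exp (-H) * (ratioMH π' q x y * ratioDA₂ π π' x y) := by
          gcongr; exact min_le_right _ _
      _ = Real.exp (-H) * ratioMH π' q x y * ratioDA₂ π π' x y := by ring
      _ ≤ _ := by gcongr

lemma acceptDA_ge_of_bounds {H m M : ℝ} (hH0 : 0 ≤ H) (hm : 0 < m) {x y : S} (hxy : 0 < q x y)
    (hyx : 0 < q y x) (hH : |logProposalRatio q x y| ≤ H)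
    (hx : π x ∈ Set.Icc m M) (hy : π y ∈ Set.Icc m M)
    (hx' : π' x ∈ Set.Icc m M) (hy' : π' y ∈ Set.Icc m M) :
    ((m / M) ^ 2 * Real.exp (-H)) ^ 2 ≤ acceptDA π π' q x y := by
  obtain ⟨hl, hu⟩ := exp_neg_le_div_le_exp hxy hyx hH
  have hM : 0 < M := hm.trans_le (hx.1.trans hx.2)
  have he1 : Real.exp (-H) ≤ 1 := Real.exp_le_one_iff.2 (by linarith)
  have he0 := Real.exp_pos (-H)
  have hmM : m / M ≤ 1 := (div_le_one hM).2 (hx.1.trans hx.2)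
  have hmM0 : 0 < m / M := div_pos hm hM
  have hdiv : ∀ a ∈ Set.Icc m M, ∀ b ∈ Set.Icc m M, m / M ≤ a / b := fun a ha b hb =>
    div_le_div₀ (hm.le.trans ha.1) ha.1 (hm.trans_le hb.1) hb.2
  -- A common lower bound for `r₁ ≥ (m / M) exp (-H)`, `r₂ ≥ (m / M)²` and `1`.
  set b := (m / M) ^ 2 * Real.exp (-H) with hb
  have hb0 : 0 < b := by positivity
  have hb1 : b ≤ 1 := mul_le_one₀ (pow_le_one₀ hmM0.le hmM) he0.le he1
  have hr1 : b ≤ ratioMH π' q x y := by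
    rw [ratioMH_eq_div_mul, hb]
    have := hdiv _ hy' _ hx'
    exact mul_le_mul ((pow_le_of_le_one hmM0.le hmM two_ne_zero).trans this) hl he0.le
      (hmM0.le.trans this)
  have hr2 : b ≤ ratioDA₂ π π' x y := by
    have e : ratioDA₂ π π' x y = (π y / π' y) * (π' x / π x) := by
      rw [ratioDA₂, div_div_eq_mul_div, mul_div_assoc]
    rw [e, hb]
    refine (mul_le_of_le_one_right (by positivity) he1).trans ?_
    rw [pow_two]
    exact mul_le_mul (hdiv _ hy _ hy') (hdiv _ hx' _ hx) hmM0.le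
      (hmM0.le.trans (hdiv _ hy _ hy'))
  rw [acceptDA, pow_two]
  exact mul_le_mul (le_min hb1 hr1) (le_min hb1 hr2) hb0.le (hb0.le.trans (le_min hb1 hr1))

end Acceptance

/-! ### Measurability of the acceptance probabilities. -/

section Ratios

variable {S : Type*} [MeasurableSpace S] {π π' : S → ℝ} {q : S → S → ℝ}

lemma measurable_ratioMH (hπ : Measurable π) (hq : Measurable (Function.uncurry q)) :
    Measurable (Function.uncurry (ratioMH π q)) :=
  ((hπ.comp measurable_snd).mul (hq.comp measurable_swap)).div
    ((hπ.comp measurable_fst).mul hq)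

lemma measurable_acceptMH (hπ : Measurable π) (hq : Measurable (Function.uncurry q)) :
    Measurable (Function.uncurry (acceptMH π q)) :=
  measurable_const.min (measurable_ratioMH hπ hq)

lemma measurable_acceptDA (hπ : Measurable π) (hπ' : Measurable π')
    (hq : Measurable (Function.uncurry q)) : Measurable (Function.uncurry (acceptDA π π' q)) :=
  (measurable_const.min (measurable_ratioMH hπ' hq)).mul (measurable_const.min
    (((hπ.div hπ').comp measurable_snd).div ((hπ.div hπ').comp measurable_fst)))

end Ratios

/-! ### Compactness bounds and the three-case comparison on `ℝᵈ`. -/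

section Euclidean

variable {d : ℕ}

lemma isBounded_seminorm_le {N : Seminorm ℝ (EuclideanSpace ℝ (Fin d))}
    (hNc : Continuous N) (hN : ∀ x, N x = 0 → x = 0) (R : ℝ) :
    Bornology.IsBounded {x | N x ≤ R} := by
  obtain ⟨a, ha0, ha⟩ := (isCompact_sphere (0 : EuclideanSpace ℝ (Fin d)) 1).exists_forall_le'
    (f := N) hNc.continuousOn (a := 0) fun x hx => by
      refine lt_of_le_of_ne (apply_nonneg N x) fun h0 => ?_
      rw [hN x h0.symm] at hx
      simp at hx
  refine (Metric.isBounded_closedBall (x := (0 : EuclideanSpace ℝ (Fin d))) (r := R / a)).subset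
    fun x hx => ?_
  have hx' : N x ≤ R := hx
  rw [mem_closedBall_zero_iff, le_div_iff₀ ha0]
  rcases eq_or_ne x 0 with rfl | hx0
  · simpa using hx'
  · have hpos : 0 < ‖x‖ := norm_pos_iff.2 hx0
    have h1 := ha (‖x‖⁻¹ • x) (by simp [norm_smul, hpos.ne'])
    rw [map_smul_eq_mul, norm_inv, norm_norm, inv_mul_eq_div, le_div_iff₀ hpos] at h1
    linarith

lemma Seminorm.continuous_euclideanSpace (N : Seminorm ℝ (EuclideanSpace ℝ (Fin d))) :
    Continuous N :=
  continuousOn_univ.1 (N.convexOn.continuousOn isOpen_univ)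

lemma exists_bounds_of_seminorm_le (X : Set (EuclideanSpace ℝ (Fin d)))
    {N : Seminorm ℝ (EuclideanSpace ℝ (Fin d))} (hN : ∀ x, N x = 0 → x = 0)
    {f : EuclideanSpace ℝ (Fin d) → ℝ} (hf : ContinuousOn f (closure X))
    (hf0 : ∀ x ∈ closure X, 0 < f x) (R : ℝ) :
    ∃ m M : ℝ, 0 < m ∧ ∀ x ∈ X, N x ≤ R → f x ∈ Set.Icc m M := by
  have hNc := N.continuous_euclideanSpace
  have hK : IsCompact (closure X ∩ {x | N x ≤ R}) :=
    Metric.isCompact_of_isClosed_isBounded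
      (isClosed_closure.inter (isClosed_le hNc continuous_const))
      ((isBounded_seminorm_le hNc hN R).subset Set.inter_subset_right)
  have hfK := hf.mono (Set.inter_subset_left (t := {x | N x ≤ R}))
  obtain ⟨m, hm0, hm⟩ := hK.exists_forall_le' hfK (a := 0) fun x hx => hf0 x hx.1
  obtain ⟨M, hM⟩ := hK.bddAbove_image hfK
  exact ⟨m, M, hm0, fun x hx hxR => ⟨hm x ⟨subset_closure hx, hxR⟩,
    hM ⟨x, ⟨subset_closure hx, hxR⟩, rfl⟩⟩⟩

/-- Off `closure X` the function is arbitrary, so it is first replaced there by zero. -/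
lemma measurable_comp_val {X : Set (EuclideanSpace ℝ (Fin d))} {f : EuclideanSpace ℝ (Fin d) → ℝ}
    (hf : ContinuousOn f (closure X)) : Measurable fun x : StateSpace X => f x.val := by
  classical
  have h1 : Measurable ((closure X).piecewise f fun _ => 0) :=
    hf.measurable_piecewise continuousOn_const isClosed_closure.measurableSet
  have h2 : (fun x : StateSpace X => f x.val) =
      fun x => (closure X).piecewise f (fun _ => 0) x.val := by
    funext x
    rw [Set.piecewise_eq_of_mem _ _ _ (subset_closure x.2 : x.val ∈ closure X)]
  rw [h2]
  intro s hs
  exact ⟨_, (h1 hs).nullMeasurableSet, rfl⟩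

/-- Up to an arbitrarily small amount of proposal mass, the delayed-acceptance probability is bounded
below by a multiple of the Metropolis-Hastings acceptance probability. -/
lemma exists_acceptDA_lt_mass_le (X : Set (EuclideanSpace ℝ (Fin d)))
    (N : Seminorm ℝ (EuclideanSpace ℝ (Fin d))) (hN : ∀ x, N x = 0 → x = 0)
    (π π' : EuclideanSpace ℝ (Fin d) → ℝ)
    (hπ_cont : ContinuousOn π (closure X)) (hπ_pos : ∀ x ∈ closure X, 0 < π x)
    (hπ'_cont : ContinuousOn π' (closure X)) (hπ'_pos : ∀ x ∈ closure X, 0 < π' x)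
    (q : StateSpace X → StateSpace X → ℝ) (hq0 : ∀ x y, 0 ≤ q x y)
    (hlocal : IsLocalProposal N q)
    (hheavy : HasHeavyTails N (fun x : StateSpace X => π' x.val) fun x : StateSpace X => π x.val)
    (ν : Measure (StateSpace X))
    (hΔ : ∀ ε : ℝ, 0 < ε → ∃ (D : StateSpace X → Set (StateSpace X)) (h : ℝ → ℝ),
      (∀ R, BddAbove (h '' Set.Icc 0 R)) ∧ ∀ᵐ x ∂ν,
        ∫⁻ y in (D x)ᶜ, ENNReal.ofReal (q x y) ∂(StateSpace.lebesgue X) ≤ ENNReal.ofReal ε ∧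
        {y | y ∈ D x ∧ h (N (y.val - x.val)) < |logProposalRatio q x y|} ⊆
          noProblemSet (fun x : StateSpace X => π x.val) (fun x : StateSpace X => π' x.val) q x)
    {ε : ℝ} (hε : 0 < ε) :
    ∃ c : ℝ, 0 < c ∧ ∀ᵐ x ∂ν,
      ∫⁻ y in {y | acceptDA (fun x : StateSpace X => π x.val) (fun x : StateSpace X => π' x.val)
          q x y < c * acceptMH (fun x : StateSpace X => π x.val) q x y},
        ENNReal.ofReal (q x y) ∂(StateSpace.lebesgue X) ≤ ENNReal.ofReal ε := by
  have hp : ∀ x : StateSpace X, 0 < π x.val := fun x => hπ_pos _ (subset_closure x.2)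
  have hp' : ∀ x : StateSpace X, 0 < π' x.val := fun x => hπ'_pos _ (subset_closure x.2)
  obtain ⟨ρ, hρ⟩ := hlocal (ε / 2) (by positivity)
  obtain ⟨D, h, hbdd, hD⟩ := hΔ (ε / 2) (by positivity)
  obtain ⟨r, hr0, hr⟩ := hheavy
  obtain ⟨H₀, hH₀⟩ := hbdd ρ
  set H := max H₀ 0
  have hH0 : 0 ≤ H := le_max_right _ _
  obtain ⟨m₁, M₁, hm₁, h₁⟩ := exists_bounds_of_seminorm_le X hN hπ_cont hπ_pos (r + ρ)
  obtain ⟨m₂, M₂, hm₂, h₂⟩ := exists_bounds_of_seminorm_le X hN hπ'_cont hπ'_pos (r + ρ)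
  set m := min m₁ m₂
  -- Including `m` keeps `m ≤ M` even if no point of `X` lies in the ball.
  set M := max (max M₁ M₂) m
  have hm : 0 < m := lt_min hm₁ hm₂
  have hmM : m ≤ M := le_max_right _ _
  have hM : 0 < M := hm.trans_le hmM
  have hb₁ : ∀ x : StateSpace X, N x.val ≤ r + ρ → π x.val ∈ Set.Icc m M := fun x hx =>
    Set.Icc_subset_Icc (min_le_left _ _) ((le_max_left _ _).trans (le_max_left _ _)) (h₁ _ x.2 hx)
  have hb₂ : ∀ x : StateSpace X, N x.val ≤ r + ρ → π' x.val ∈ Set.Icc m M := fun x hx =>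
    Set.Icc_subset_Icc (min_le_right _ _) ((le_max_right _ _).trans (le_max_left _ _)) (h₂ _ x.2 hx)
  set b := (m / M) ^ 2 * Real.exp (-H) with hb
  have he0 := Real.exp_pos (-H)
  have he1 : Real.exp (-H) ≤ 1 := Real.exp_le_one_iff.2 (by linarith)
  have hb0 : 0 < b := by positivity
  have hbe : b ≤ Real.exp (-H) :=
    mul_le_of_le_one_left he0.le (pow_le_one₀ (by positivity) ((div_le_one hM).2 hmM))
  have hbb : b ^ 2 ≤ b := pow_le_of_le_one hb0.le (hbe.trans he1) two_ne_zero
  -- `b²` is at most each of the constants from the three cases: `1`, `exp (-H)` and `b²`.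
  refine ⟨b ^ 2, by positivity, ?_⟩
  filter_upwards [hD] with x hx
  have hsub : {y | acceptDA (fun x : StateSpace X => π x.val) (fun x : StateSpace X => π' x.val)
      q x y < b ^ 2 * acceptMH (fun x : StateSpace X => π x.val) q x y} ⊆
      (D x)ᶜ ∪ {y : StateSpace X | N (y.val - x.val) < ρ}ᶜ := by
    intro y hy
    by_contra hmem
    rw [Set.mem_union, not_or, Set.notMem_compl_iff, Set.notMem_compl_iff] at hmem
    obtain ⟨hyD, hyρ⟩ := hmem
    have hyρ' : N (y.val - x.val) < ρ := hyρ
    have hy' : acceptDA (fun x : StateSpace X => π x.val) (fun x : StateSpace X => π' x.val) q x y <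
        b ^ 2 * acceptMH (fun x : StateSpace X => π x.val) q x y := hy
    refine absurd hy' (not_lt.2 ?_)
    have hMH0 : 0 ≤ acceptMH (fun x : StateSpace X => π x.val) q x y :=
      le_min zero_le_one (ratioMH_nonneg hp hq0 x y)
    have hMH1 := acceptMH_le_one (π := fun x : StateSpace X => π x.val) (q := q) x y
    -- If either proposal density vanishes, the Metropolis-Hastings ratio is `0`, by division by
    -- zero or by its numerator.
    rcases (hq0 x y).eq_or_lt with hxy | hxy
    · rw [acceptMH_eq_zero (.inl hxy.symm), mul_zero]
      exact acceptDA_nonneg hp hp' hq0 x y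
    rcases (hq0 y x).eq_or_lt with hyx | hyx
    · rw [acceptMH_eq_zero (.inr hyx.symm), mul_zero]
      exact acceptDA_nonneg hp hp' hq0 x y
    rcases lt_or_ge H |logProposalRatio q x y| with hΔy | hΔy
    · have hle : h (N (y.val - x.val)) ≤ H :=
        (hH₀ ⟨_, ⟨apply_nonneg N _, hyρ'.le⟩, rfl⟩).trans (le_max_left _ _)
      refine le_trans ?_ (acceptMH_le_acceptDA_of_mem_noProblemSet hp hp' hxy hyx
        (hx.2 ⟨hyD, hle.trans_lt hΔy⟩))
      exact mul_le_of_le_one_left hMH0 (hbb.trans (hbe.trans he1))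
    by_cases hfar : r < N x.val ∧ r < N y.val
    · refine le_trans ?_ (acceptMH_le_acceptDA_of_heavy hp hp' hH0 hxy hyx hΔy
        (hr x y hfar.1 hfar.2) (hr y x hfar.2 hfar.1))
      exact mul_le_mul_of_nonneg_right (hbb.trans hbe) hMH0
    -- One point lies within radius `r` and the points are less than `ρ` apart, so both lie within
    -- `r + ρ`.
    · have hρ0 : 0 < ρ := (apply_nonneg N _).trans_lt hyρ'
      have hyx' : N y.val ≤ N x.val + N (y.val - x.val) := by
        have := map_add_le_add N x.val (y.val - x.val)
        rwa [add_sub_cancel] at this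
      have hxy' : N x.val ≤ N y.val + N (y.val - x.val) := by
        have := map_add_le_add N y.val (x.val - y.val)
        rwa [add_sub_cancel, map_sub_rev] at this
      have hnear : N x.val ≤ r + ρ ∧ N y.val ≤ r + ρ := by
        rw [not_and_or, not_lt, not_lt] at hfar
        rcases hfar with hfar | hfar <;> constructor <;> linarith
      refine le_trans (mul_le_of_le_one_right (by positivity) hMH1) ?_
      exact acceptDA_ge_of_bounds hH0 hm hxy hyx hΔy (hb₁ x hnear.1) (hb₁ y hnear.2)
        (hb₂ x hnear.1) (hb₂ y hnear.2)
  refine (lintegral_mono_set hsub).trans ((lintegral_union_le _ _ _).trans ?_)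
  refine (add_le_add hx.1 (hρ x).le).trans ?_
  rw [← ENNReal.ofReal_add (by positivity) (by positivity), add_halves]

end Euclidean

/-! ### The main theorem. -/

theorem theorem3 {d : ℕ} (X : Set (EuclideanSpace ℝ (Fin d)))
    (hX : NullMeasurableSet X volume)
    -- the norm on `ℝᵈ`
    (N : Seminorm ℝ (EuclideanSpace ℝ (Fin d))) (hN : ∀ x, N x = 0 → x = 0)
    -- the target density and the surrogate, continuous and positive
    (π π' : EuclideanSpace ℝ (Fin d) → ℝ)
    (hπ_cont : ContinuousOn π (closure X)) (hπ_pos : ∀ x ∈ closure X, 0 < π x)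
    (hπ'_cont : ContinuousOn π' (closure X)) (hπ'_pos : ∀ x ∈ closure X, 0 < π' x)
    (hπ_one : ∫⁻ x : StateSpace X, ENNReal.ofReal (π x.val) ∂(StateSpace.lebesgue X) = 1)
    -- the proposal
    (q : StateSpace X → StateSpace X → ℝ)
    (hq : IsProposalDensity (StateSpace.lebesgue X) q)
    (hlocal : IsLocalProposal N q)
    (hheavy : HasHeavyTails N (fun x : StateSpace X => π' x.val)
      (fun x : StateSpace X => π x.val))
    -- the control on `Δ(x, y; q)` outside the "no problem" set
    (hΔ : ∀ ε : ℝ, 0 < ε → ∃ (D : StateSpace X → Set (StateSpace X)) (h : ℝ → ℝ),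
      (∀ r, 0 ≤ r → 0 ≤ h r) ∧ (∀ R, BddAbove (h '' Set.Icc 0 R)) ∧
      ∀ᵐ x ∂(target (fun x : StateSpace X => π x.val)),
        MeasurableSet (D x) ∧
        ∫⁻ y in (D x)ᶜ, ENNReal.ofReal (q x y) ∂(StateSpace.lebesgue X) ≤ ENNReal.ofReal ε ∧
        {y | y ∈ D x ∧ h (N (y.val - x.val)) < |logProposalRatio q x y|} ⊆
          noProblemSet (fun x : StateSpace X => π x.val) (fun x : StateSpace X => π' x.val) q x)
    (hMH : IsVarianceBounding (kernelMH (fun x : StateSpace X => π x.val) q)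
      (target (fun x : StateSpace X => π x.val))) :
    IsVarianceBounding
      (kernelDA (fun x : StateSpace X => π x.val) (fun x : StateSpace X => π' x.val) q)
      (target (fun x : StateSpace X => π x.val)) := by

  have hp : ∀ x : StateSpace X, 0 < π x.val := fun x => hπ_pos _ (subset_closure x.2)
  have hp' : ∀ x : StateSpace X, 0 < π' x.val := fun x => hπ'_pos _ (subset_closure x.2)
  have hpm := measurable_comp_val hπ_cont
  have hpm' := measurable_comp_val hπ'_cont
  have hMHm := measurable_acceptMH hpm hq.measurable
  have hDAm := measurable_acceptDA hpm hpm' hq.measurable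
  have hprob : IsProbabilityMeasure (target fun x : StateSpace X => π x.val) := by
    refine ⟨?_⟩
    rw [target, withDensity_apply _ MeasurableSet.univ, setLIntegral_univ, hπ_one]
  have hmarkovMH : IsMarkovKernel (kernelMH (fun x : StateSpace X => π x.val) q) :=
    isMarkovKernel_proposeAcceptReject hq hMHm acceptMH_le_one
  have hmarkovDA : IsMarkovKernel
      (kernelDA (fun x : StateSpace X => π x.val) (fun x : StateSpace X => π' x.val) q) :=
    isMarkovKernel_proposeAcceptReject hq hDAm fun x y =>
      acceptDA_le_one x y (ratioDA₂_pos hp hp' x y).le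
  have hrevMH : (kernelMH (fun x : StateSpace X => π x.val) q).IsReversible
      (target fun x : StateSpace X => π x.val) :=
    isReversible_proposeAcceptReject hpm (fun x => (hp x).le) hq.measurable hMHm
      (acceptMH_symm hp hq.nonneg)
  have hrevDA :
      (kernelDA (fun x : StateSpace X => π x.val) (fun x : StateSpace X => π' x.val) q).IsReversible
        (target fun x : StateSpace X => π x.val) :=
    isReversible_proposeAcceptReject hpm (fun x => (hp x).le) hq.measurable hDAm
      (acceptDA_symm hp hp' hq.nonneg)
  have hcond := hasPositiveConductance_of_isVarianceBounding hrevMH hMH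
  refine isVarianceBounding_of_hasPositiveConductance hrevDA ?_
  refine hasPositiveConductance_of_accept_le hq hMHm hDAm acceptMH_le_one (fun ε hε => ?_)
    hcond
  refine exists_acceptDA_lt_mass_le X N hN π π' hπ_cont hπ_pos hπ'_cont hπ'_pos q hq.nonneg hlocal
    hheavy _ (fun ε hε => ?_) hε
  obtain ⟨D, h, -, hbdd, hD⟩ := hΔ ε hε
  exact ⟨D, h, hbdd, hD.mono fun x hx => hx.2⟩
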